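/- Let $N\ge 0$, let $A=(a_{ij})$ be a symmetric positive definite $N\times N$ matrix with rational entries, $B\in\mathbb Q^N$, $C\in\mathbb Q$, and put $Q(n)=\frac12 n^tAn+B^tn+C$. Write $\mathbf e(x)=e^{2\pi i x}$, $(q)_n=(1-q)\cdots(1-q^n)$, and let $$f_Q(\tau)=\sum_{n\in\mathbb Z_{\ge0}^N}\frac{q^{Q(n)}}{(q)_{n_1}\cdots(q)_{n_N}},\qquad q=\mathbf e(\tau),\quad q^{\lambda}=\mathbf e(\lambda\tau)\ (\lambda\in\mathbb Q),\quad \operatorname{Im}\tau>0,$$ be the associated Nahm sum. Let $X_A=(X_1,\dots,X_N)$ be the unique solution in $(0,1)^N$ of the Nahm equation $1-X_i=\prod_{j=1}^N X_j^{a_{ij}}$ $(i=1,\dots,N)$, and set $$C_0(A)=\frac{1}{(2\pi)^2}\sum_{i=1}^N \mathrm L(X_i),\qquad \mathrm L(z)=\mathrm{Li}_2(z)+\tfrac12\log z\,\log(1-z)-\tfrac{\pi^2}{6},\qquad \mathrm{Li}_2(z)=\sum_{k\ge1}\frac{z^k}{k^2}.$$ For a function $g$ on the upper half plane invariant under a subgroup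 of finite index of $\mathrm{SL}_2(\mathbb Z)$ and $P\in\mathbb P^1(\mathbb Q)=\mathbb Q\cup\{\infty\}$, the valuation $v_P(g)\in\mathbb Q$ is the smallest exponent of $q$ in the Fourier expansion of $g\circ\gamma$, for any $\gamma\in\mathrm{SL}_2(\mathbb Z)$ with $\gamma(\infty)=P$ (it does not depend on the choice of $\gamma$). Proposition. Suppose that $f_Q$ is modular, i.e. invariant under a subgroup of finite index of $\mathrm{SL}_2(\mathbb Z)$ (not necessarily a congruence subgroup). Then for every $P\in\mathbb P^1(\mathbb Q)$ the valuation $v_P(f_Q)$ exists (the Fourier expansion has a smallest exponent) and $$v_P(f_Q)\ \ge\ C_0(A),$$ with equality when $P=0$. -/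

import Mathlib

open scoped MatrixGroups
open UpperHalfPlane

noncomputable section

namespace Nahm

/-- The quadratic function `Q(n) = ½ nᵗ A n + B n + C`, with rational values on integral vectors. -/
def quad {N : ℕ} (A : Matrix (Fin N) (Fin N) ℚ) (B : Fin N → ℚ) (C : ℚ) (n : Fin N → ℕ) : ℚ :=
  1 / 2 * (∑ i, ∑ j, (n i : ℚ) * A i j * (n j : ℚ)) + (∑ i, B i * (n i : ℚ)) + C

/-- The exponential `𝐞(x) = exp(2πix)`. -/
def e (x : ℂ) : ℂ := Complex.exp (2 * (Real.pi : ℂ) * Complex.I * x)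

/-- The `q`-factorial `(q)_n = (1 - q)(1 - q²) ⋯ (1 - qⁿ)`. -/
def qFactorial (q : ℂ) (n : ℕ) : ℂ := ∏ k ∈ Finset.range n, (1 - q ^ (k + 1))

/-- The Nahm sum `f_Q(τ) = ∑_{n ∈ ℤ_{≥0}^N} q^{Q(n)} / ((q)_{n_1} ⋯ (q)_{n_N})` on the upper half
plane, where `q = 𝐞(τ)` and `q^r = 𝐞(rτ)` for rational `r`. -/
def nahmSum {N : ℕ} (A : Matrix (Fin N) (Fin N) ℚ) (B : Fin N → ℚ) (C : ℚ) (τ : ℍ) : ℂ :=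
  ∑' n : Fin N → ℕ, e ((quad A B C n : ℂ) * (τ : ℂ)) / ∏ i, qFactorial (e (τ : ℂ)) (n i)

/-- A modular function is a function invariant under a subgroup of finite index of `SL(2,ℤ)`
(not necessarily a congruence subgroup). -/
def IsModular (g : ℍ → ℂ) : Prop :=
  ∃ Γ : Subgroup SL(2, ℤ), Γ.FiniteIndex ∧ ∀ γ ∈ Γ, ∀ τ : ℍ, g (γ • τ) = g τ

/-- `v` is the smallest exponent of `q = 𝐞(τ)` in the Fourier expansion of `g` in (integral)
powers of `q^{1/h}` for some positive integer `h`, this expansion being valid on the whole upper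
half plane. -/
def IsOrderAtInfty (g : ℍ → ℂ) (v : ℚ) : Prop :=
  ∃ (h : ℕ) (a : ℤ → ℂ) (n₀ : ℤ), 0 < h ∧
    (∀ τ : ℍ, HasSum (fun n : ℤ => a n * e ((n : ℂ) / (h : ℂ) * (τ : ℂ))) (g τ)) ∧
    IsLeast {n : ℤ | a n ≠ 0} n₀ ∧ v = (n₀ : ℚ) / (h : ℚ)

/-- `v` is the valuation of `g` at the cusp `P ∈ ℙ¹(ℚ) = ℚ ∪ {∞}`: for every `γ ∈ SL(2,ℤ)`
with `γ(∞) = P`, it is the smallest exponent of `q` in the Fourier expansion of `g ∘ γ`. -/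
def IsValuationAt (g : ℍ → ℂ) (P : OnePoint ℚ) (v : ℚ) : Prop :=
  ∀ γ : SL(2, ℤ), Matrix.SpecialLinearGroup.mapGL ℚ γ • (OnePoint.infty : OnePoint ℚ) = P →
    IsOrderAtInfty (fun τ : ℍ => g (γ • τ)) v

/-- The dilogarithm `Li₂(z) = ∑_{k ≥ 1} z^k / k²` for real `z` with `|z| ≤ 1`. -/
def Li2 (z : ℝ) : ℝ := ∑' k : ℕ, z ^ (k + 1) / ((k : ℝ) + 1) ^ 2

/-- The Rogers dilogarithm on `(0,1)`, shifted by a constant so that its limit at `1` is `0`. -/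
def rogersL (z : ℝ) : ℝ :=
  Li2 z + 1 / 2 * Real.log z * Real.log (1 - z) - Real.pi ^ 2 / 6

/-- `X ∈ (0,1)^N` solves the Nahm equation `1 - X_i = ∏_j X_j^{A_ij}`. -/
def IsNahmSolution {N : ℕ} (A : Matrix (Fin N) (Fin N) ℚ) (X : Fin N → ℝ) : Prop :=
  (∀ i, X i ∈ Set.Ioo (0 : ℝ) 1) ∧ ∀ i, 1 - X i = ∏ j, X j ^ ((A i j : ℚ) : ℝ)

/-- `A` is (symmetric and) positive definite as a real matrix. -/
def IsPosDef {N : ℕ} (A : Matrix (Fin N) (Fin N) ℚ) : Prop :=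
  (A.map (fun x : ℚ => (x : ℝ))).PosDef

/-- The distinguished solution `X_A ∈ (0,1)^N` of the Nahm equation of `A`; for positive definite
`A` it exists and is unique by `existsUnique_isNahmSolution` below. -/
def nahmSolution {N : ℕ} (A : Matrix (Fin N) (Fin N) ℚ) : Fin N → ℝ :=
  Classical.epsilon (IsNahmSolution A)

/-- `C₀(A) = L(ξ_A) / (2π)²`, where `ξ_A = ∑_i [X_{A,i}]` and `L` is the Rogers dilogarithm
normalized by `L(1) = 0`, so that `L(ξ_A) = ∑_i L(X_{A,i})`. -/
def C0 {N : ℕ} (A : Matrix (Fin N) (Fin N) ℚ) : ℝ :=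
  (∑ i, rogersL (nahmSolution A i)) / (2 * Real.pi) ^ 2

/-! The remaining facts show that the distinguished solution of the Nahm equation is
well defined. -/

lemma abs_term_le {z : ℝ} (hz : |z| ≤ 1) (k : ℕ) :
    ‖z ^ (k + 1) / ((k : ℝ) + 1) ^ 2‖ ≤ 1 / ((k : ℝ) + 1) ^ 2 := by
  rw [norm_div, norm_pow, Real.norm_eq_abs, Real.norm_of_nonneg (by positivity)]
  gcongr
  exact pow_le_one₀ (abs_nonneg _) hz

lemma summable_inv_sq : Summable (fun k : ℕ => 1 / ((k : ℝ) + 1) ^ 2) := by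
  have := (summable_nat_add_iff 1).2 (Real.summable_one_div_nat_pow.2 (by norm_num : 1 < 2))
  simpa using this

lemma Li2_nonneg {z : ℝ} (hz : 0 ≤ z) : 0 ≤ Li2 z :=
  tsum_nonneg fun k => by positivity

/-- `u ↦ Li₂(exp(-|u|))`. -/
def pot (u : ℝ) : ℝ := Li2 (Real.exp (-|u|))

lemma pot_continuous : Continuous pot := by
  unfold pot Li2
  refine continuous_tsum (fun k => by fun_prop) summable_inv_sq fun k u => abs_term_le ?_ k
  rw [abs_of_pos (Real.exp_pos _)]
  exact Real.exp_le_one_iff.2 (by simp)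

lemma pot_nonneg (u : ℝ) : 0 ≤ pot u := Li2_nonneg (Real.exp_pos _).le

lemma hasDerivAt_pot {u : ℝ} (hu : 0 < u) :
    HasDerivAt pot (Real.log (1 - Real.exp (-u))) u := by
  have hexp : ∀ y : ℝ, 0 < y → Real.exp (-y) < 1 := fun y hy => Real.exp_lt_one_iff.mpr (by linarith)
  have key : HasDerivAt (fun y : ℝ => ∑' k : ℕ, Real.exp (-y) ^ (k + 1) / ((k : ℝ) + 1) ^ 2)
      (∑' k : ℕ, -(Real.exp (-u) ^ (k + 1) / ((k : ℝ) + 1))) u := by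
    refine hasDerivAt_tsum_of_isPreconnected
      (g := fun (k : ℕ) (y : ℝ) => Real.exp (-y) ^ (k + 1) / ((k : ℝ) + 1) ^ 2)
      (g' := fun (k : ℕ) (y : ℝ) => -(Real.exp (-y) ^ (k + 1) / ((k : ℝ) + 1)))
      (u := fun k : ℕ => Real.exp (-(u / 2)) ^ (k + 1)) (t := Set.Ioi (u / 2)) ?_
      isOpen_Ioi isPreconnected_Ioi ?_ ?_ (y₀ := u) (y := u)
      (show u / 2 < u by linarith) ?_
      (show u / 2 < u by linarith)
    · exact (summable_nat_add_iff 1).2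
        (summable_geometric_of_lt_one (Real.exp_pos _).le (hexp _ (by linarith)))
    · intro k y _
      have h1 : HasDerivAt (fun y : ℝ => Real.exp (-y)) (Real.exp (-y) * (-1)) y :=
        ((hasDerivAt_id y).neg).exp
      have h2 := (h1.pow (k + 1)).div_const (((k : ℝ) + 1) ^ 2)
      refine h2.congr_deriv ?_
      have : (k : ℝ) + 1 ≠ 0 := by positivity
      push_cast
      field_simp
      ring
    · intro k y hy
      have hy : u / 2 < y := hy
      rw [norm_neg, Real.norm_of_nonneg (by positivity)]
      calc Real.exp (-y) ^ (k + 1) / ((k : ℝ) + 1) ≤ Real.exp (-y) ^ (k + 1) :=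
            div_le_self (by positivity) (by linarith [(Nat.cast_nonneg k : (0 : ℝ) ≤ k)])
        _ ≤ _ := by gcongr
    · refine Summable.of_norm_bounded summable_inv_sq fun k => abs_term_le ?_ k
      rw [abs_of_pos (Real.exp_pos _)]
      exact (hexp u hu).le
  have hs : HasSum (fun k : ℕ => Real.exp (-u) ^ (k + 1) / ((k : ℝ) + 1))
      (-Real.log (1 - Real.exp (-u))) :=
    Real.hasSum_pow_div_log_of_abs_lt_one (by rw [abs_of_pos (Real.exp_pos _)]; exact hexp u hu)
  rw [tsum_neg, hs.tsum_eq, neg_neg] at key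
  refine key.congr_of_eventuallyEq ?_
  filter_upwards [lt_mem_nhds hu] with y hy
  simp [pot, Li2, abs_of_pos hy]

open Filter Topology in
lemma exists_critical {N : ℕ} (M : Matrix (Fin N) (Fin N) ℝ) (hM : M.PosDef) :
    ∃ u : Fin N → ℝ, (∀ i, 0 < u i) ∧
      ∀ i, M.mulVec u i + Real.log (1 - Real.exp (-(u i))) = 0 := by
  classical
  set F : (Fin N → ℝ) → ℝ := fun u => 1 / 2 * dotProduct u (M.mulVec u) + ∑ i, pot (u i) with hF
  have hcq : Continuous fun u : Fin N → ℝ => dotProduct u (M.mulVec u) := by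
    simp only [dotProduct, Matrix.mulVec]
    fun_prop
  have hcF : Continuous F := by
    have := pot_continuous
    simp only [hF]
    fun_prop
  have hpos : ∀ u : Fin N → ℝ, u ≠ 0 → 0 < dotProduct u (M.mulVec u) := fun u hu => by
    simpa using hM.dotProduct_mulVec_pos hu
  obtain ⟨c, hc, hcle⟩ : ∃ c : ℝ, 0 < c ∧
      ∀ u : Fin N → ℝ, c * ‖u‖ ^ 2 ≤ dotProduct u (M.mulVec u) := by
    rcases (Metric.sphere (0 : Fin N → ℝ) 1).eq_empty_or_nonempty with hE | hE
    · refine ⟨1, one_pos, fun u => ?_⟩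
      by_cases hu : u = 0
      · simp [hu]
      · exfalso
        have : (‖u‖⁻¹ • u) ∈ Metric.sphere (0 : Fin N → ℝ) 1 := by
          simp [norm_smul, inv_mul_cancel₀ (norm_ne_zero_iff.2 hu)]
        rw [hE] at this
        exact this
    · obtain ⟨w, hw, hmin⟩ := (isCompact_sphere (0 : Fin N → ℝ) 1).exists_isMinOn hE
        hcq.continuousOn
      have hw0 : w ≠ 0 := by
        rintro rfl
        simp at hw
      refine ⟨_, hpos w hw0, fun u => ?_⟩
      by_cases hu : u = 0
      · simp [hu]
      · have hn : ‖u‖ ≠ 0 := norm_ne_zero_iff.2 hu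
        have hm : (‖u‖⁻¹ • u) ∈ Metric.sphere (0 : Fin N → ℝ) 1 := by
          simp [norm_smul, inv_mul_cancel₀ hn]
        have h := hmin hm
        simp only [Set.mem_ofPred_eq, Matrix.mulVec_smul, dotProduct_smul, smul_dotProduct,
          smul_eq_mul] at h
        calc _ ≤ (‖u‖⁻¹ * (‖u‖⁻¹ * dotProduct u (M.mulVec u))) * ‖u‖ ^ 2 := by gcongr
          _ = _ := by field_simp
  have hco : ∀ᶠ u in cocompact (Fin N → ℝ) ⊓ 𝓟 {u | ∀ i, 0 ≤ u i}, F 0 ≤ F u := by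
    refine Filter.Eventually.filter_mono inf_le_left ?_
    have ht : Tendsto (fun u : Fin N → ℝ => 1 / 2 * (c * ‖u‖ ^ 2)) (cocompact _) atTop :=
      (((tendsto_pow_atTop two_ne_zero).comp
        (tendsto_norm_cocompact_atTop)).const_mul_atTop hc).const_mul_atTop (by norm_num)
    filter_upwards [ht.eventually_ge_atTop (F 0)] with u hu
    have h1 := hcle u
    have h2 : 0 ≤ ∑ i, pot (u i) := Finset.sum_nonneg fun i _ => pot_nonneg _
    simp only [hF] at hu ⊢
    linarith
  have hcl : IsClosed {u : Fin N → ℝ | ∀ i, 0 ≤ u i} := by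
    simp only [Set.ofPred_forall]
    exact isClosed_iInter fun i => isClosed_le continuous_const (continuous_apply i)
  obtain ⟨u, hu, hmin⟩ := hcF.continuousOn.exists_isMinOn' hcl
    (x₀ := 0) (by simp) hco
  have hsym : ∀ x y : Fin N → ℝ, dotProduct x (M.mulVec y) = dotProduct y (M.mulVec x) := by
    intro x y
    have hT : M.transpose = M := by simpa using hM.1.eq
    rw [Matrix.dotProduct_mulVec, ← Matrix.mulVec_transpose, hT, dotProduct_comm]
  -- restriction of `F` to a line parallel to a coordinate axis
  have hline : ∀ i (t : ℝ), F (u + t • Pi.single i 1) =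
      F u + t * M.mulVec u i + 1 / 2 * t ^ 2 * M i i + (pot (u i + t) - pot (u i)) := by
    intro i t
    have h1 : ∑ j, pot ((u + t • (Pi.single i 1 : Fin N → ℝ)) j) =
        ∑ j, pot (u j) + (pot (u i + t) - pot (u i)) := by
      rw [← Finset.add_sum_erase _ _ (Finset.mem_univ i),
        ← Finset.add_sum_erase (Finset.univ) (fun j => pot (u j)) (Finset.mem_univ i)]
      have : ∑ x ∈ Finset.univ.erase i, pot ((u + t • (Pi.single i 1 : Fin N → ℝ)) x) =
          ∑ x ∈ Finset.univ.erase i, pot (u x) := by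
        refine Finset.sum_congr rfl fun j hj => ?_
        simp [Finset.ne_of_mem_erase hj]
      rw [this]
      simp
      ring
    have h2 : dotProduct (Pi.single i 1) (M.mulVec u) = M.mulVec u i := by
      simp
    have h3 : dotProduct (Pi.single i 1) (M.mulVec (Pi.single i 1)) = M i i := by
      simp
    simp only [hF, h1, Matrix.mulVec_add, Matrix.mulVec_smul, add_dotProduct, dotProduct_add,
      smul_dotProduct, dotProduct_smul, smul_eq_mul, hsym u (Pi.single i 1), h2, h3]
    ring
  have hge : ∀ i (t : ℝ), 0 ≤ u i + t →
      0 ≤ t * M.mulVec u i + 1 / 2 * t ^ 2 * M i i + (pot (u i + t) - pot (u i)) := by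
    intro i t ht
    have hmem : (u + t • (Pi.single i 1 : Fin N → ℝ)) ∈ {u : Fin N → ℝ | ∀ i, 0 ≤ u i} := by
      intro j
      by_cases hj : j = i
      · subst hj; simpa using ht
      · simpa [hj] using hu j
    have h := hmin hmem
    simp only [Set.mem_ofPred_eq, hline] at h
    linarith
  have hupos : ∀ i, 0 < u i := by
    intro i
    refine lt_of_le_of_ne (hu i) fun h0 => ?_
    have hlog : Tendsto (fun t : ℝ => M.mulVec u i + 1 / 2 * t * M i i
        + Real.log (1 - Real.exp (-t))) (𝓝[>] 0) atBot := by
      have h1 : Tendsto (fun t : ℝ => 1 - Real.exp (-t)) (𝓝[>] 0) (𝓝[>] 0) := by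
        refine tendsto_nhdsWithin_iff.2 ⟨?_, ?_⟩
        · have : Continuous fun t : ℝ => 1 - Real.exp (-t) := by fun_prop
          have := (this.tendsto 0).mono_left (nhdsWithin_le_nhds (s := Set.Ioi 0))
          simpa using this
        · filter_upwards [self_mem_nhdsWithin] with t ht
          have : Real.exp (-t) < 1 := Real.exp_lt_one_iff.mpr (by simpa using ht)
          simpa using this
      have h2 : Tendsto (fun t : ℝ => M.mulVec u i + 1 / 2 * t * M i i) (𝓝[>] 0)
          (𝓝 (M.mulVec u i)) := by
        have : Continuous fun t : ℝ => M.mulVec u i + 1 / 2 * t * M i i := by fun_prop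
        have := (this.tendsto 0).mono_left (nhdsWithin_le_nhds (s := Set.Ioi 0))
        simpa using this
      exact h2.add_atBot (Real.tendsto_log_nhdsGT_zero.comp h1)
    obtain ⟨t, ht0, htneg⟩ := (Filter.Eventually.and (f := 𝓝[>] (0 : ℝ)) (p := fun t => t ∈ Set.Ioi 0)
      self_mem_nhdsWithin (hlog.eventually_lt_atBot 0)).exists
    have ht0 : 0 < t := ht0
    obtain ⟨s, hs, hse⟩ := exists_hasDerivAt_eq_slope pot
      (fun s => Real.log (1 - Real.exp (-s))) ht0 pot_continuous.continuousOn
      (fun x hx => hasDerivAt_pot hx.1)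
    have hsl : Real.log (1 - Real.exp (-s)) ≤ Real.log (1 - Real.exp (-t)) := by
      apply Real.log_le_log
      · have : Real.exp (-s) < 1 := Real.exp_lt_one_iff.mpr (by linarith [hs.1])
        linarith
      · have : Real.exp (-t) ≤ Real.exp (-s) := Real.exp_le_exp.2 (by linarith [hs.2])
        linarith
    rw [eq_div_iff (by linarith)] at hse
    have h := hge i t (by linarith)
    rw [← h0, zero_add] at h
    nlinarith [mul_pos ht0 (sub_pos.2 htneg), mul_nonneg ht0.le (sub_nonneg.2 hsl)]
  refine ⟨u, hupos, fun i => ?_⟩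
  have hd : HasDerivAt (fun t : ℝ => t * M.mulVec u i + 1 / 2 * t ^ 2 * M i i
      + (pot (u i + t) - pot (u i))) (M.mulVec u i + Real.log (1 - Real.exp (-(u i)))) 0 := by
    have h1 : HasDerivAt (fun t : ℝ => pot (u i + t)) (Real.log (1 - Real.exp (-(u i)))) 0 := by
      have := hasDerivAt_pot (hupos i)
      refine HasDerivAt.comp_const_add (u i) 0 ?_
      simpa using this
    have h2 : HasDerivAt (fun t : ℝ => t * M.mulVec u i) (1 * M.mulVec u i) 0 :=
      (hasDerivAt_id (0 : ℝ)).mul_const _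
    have h3 : HasDerivAt (fun t : ℝ => 1 / 2 * t ^ 2 * M i i) 0 0 := by
      have := (((hasDerivAt_id (0 : ℝ)).pow 2).const_mul (1 / 2)).mul_const (M i i)
      simpa using this
    refine ((h2.add h3).add (h1.sub_const (pot (u i)))).congr_deriv ?_
    ring
  refine IsLocalMin.hasDerivAt_eq_zero ?_ hd
  filter_upwards [lt_mem_nhds (show -(u i) < 0 by linarith [hupos i])] with t ht
  have := hge i t (by linarith)
  simpa using this

/-- The Nahm equation in the coordinates `u_i = -log X_i`. -/
lemma isNahmSolution_iff {N : ℕ} (A : Matrix (Fin N) (Fin N) ℚ) (X : Fin N → ℝ)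
    (hX : ∀ i, X i ∈ Set.Ioo (0 : ℝ) 1) :
    IsNahmSolution A X ↔ ∀ i, (A.map (fun x : ℚ => (x : ℝ))).mulVec (fun j => -Real.log (X j)) i
      + Real.log (1 - X i) = 0 := by
  have h : ∀ i, Real.log (∏ j, X j ^ ((A i j : ℚ) : ℝ)) =
      -((A.map (fun x : ℚ => (x : ℝ))).mulVec (fun j => -Real.log (X j)) i) := by
    intro i
    rw [Real.log_prod (fun j _ => (Real.rpow_pos_of_pos (hX j).1 _).ne')]
    simp [Matrix.mulVec, dotProduct, Real.log_rpow (hX _).1]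
  have hp : ∀ i, 0 < ∏ j, X j ^ ((A i j : ℚ) : ℝ) := fun i =>
    Finset.prod_pos fun j _ => Real.rpow_pos_of_pos (hX j).1 _
  refine ⟨fun hN i => ?_, fun hN => ⟨hX, fun i => ?_⟩⟩
  · rw [hN.2 i, h i]; ring
  · refine Real.log_injOn_pos (Set.mem_Ioi.2 (by linarith [(hX i).2])) (hp i) ?_
    rw [h i]
    linarith [hN i]

/-- The Nahm equation of a positive definite matrix has exactly one solution in `(0,1)^N`. -/
theorem existsUnique_isNahmSolution {N : ℕ} (A : Matrix (Fin N) (Fin N) ℚ) (hA : IsPosDef A) :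
    ∃! X : Fin N → ℝ, IsNahmSolution A X := by
  obtain ⟨u, hu, hcrit⟩ := exists_critical _ hA
  refine existsUnique_of_exists_of_unique ⟨fun i => Real.exp (-(u i)), ?_⟩ ?_
  · rw [isNahmSolution_iff A _ fun i => ⟨Real.exp_pos _, Real.exp_lt_one_iff.mpr (by linarith [hu i])⟩]
    simpa using hcrit
  · intro X Y hX hY
    have h1 := (isNahmSolution_iff A X hX.1).1 hX
    have h2 := (isNahmSolution_iff A Y hY.1).1 hY
    set w : Fin N → ℝ := (fun j => -Real.log (X j)) - fun j => -Real.log (Y j) with hw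
    have hle : dotProduct w ((A.map (fun x : ℚ => (x : ℝ))).mulVec w) ≤ 0 := by
      refine Finset.sum_nonpos fun i _ => ?_
      have hv : (A.map (fun x : ℚ => (x : ℝ))).mulVec w i =
          Real.log (1 - Y i) - Real.log (1 - X i) := by
        rw [hw, Matrix.mulVec_sub, Pi.sub_apply]
        linarith [h1 i, h2 i]
      have hwi : w i = Real.log (Y i) - Real.log (X i) := by simp [hw]; ring
      rw [hv, hwi]
      rcases le_total (X i) (Y i) with h | h
      · refine mul_nonpos_of_nonneg_of_nonpos
          (sub_nonneg.2 (Real.log_le_log (hX.1 i).1 h))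
          (sub_nonpos.2 (Real.log_le_log (by linarith [(hY.1 i).2]) (by linarith)))
      · refine mul_nonpos_of_nonpos_of_nonneg
          (sub_nonpos.2 (Real.log_le_log (hY.1 i).1 h))
          (sub_nonneg.2 (Real.log_le_log (by linarith [(hX.1 i).2]) (by linarith)))
    have hw0 : w = 0 := by
      by_contra hne
      have h := hA.dotProduct_mulVec_pos hne
      rw [star_trivial] at h
      linarith
    funext i
    have hi := congrFun hw0 i
    simp only [hw, Pi.sub_apply, Pi.zero_apply] at hi
    exact Real.log_injOn_pos (hX.1 i).1 (hY.1 i).1 (by linarith)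

/-- The distinguished solution is a solution. -/
theorem nahmSolution_spec {N : ℕ} (A : Matrix (Fin N) (Fin N) ℚ) (hA : IsPosDef A) :
    IsNahmSolution A (nahmSolution A) :=
  Classical.epsilon_spec (existsUnique_isNahmSolution A hA).exists

end Nahm

end

namespace Nahm

open Filter Topology

/-! ### The function `pot` -/

/-! The valuation at a cusp is an exponential growth rate, and growth rates of Nahm sums follow from
Laplace's method. Put `ε = 2π Im τ`. On the imaginary axis the logarithm of a `q`-factorial is a
Riemann sum of `log(1 - e^{-u}) = pot'(u)`. With `u = εn`, the logarithm of the `n`-th term is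
therefore about `(N·pot 0 - potential A u)/ε`. The potential is convex with critical point `-log
X_A`, and its minimum is `N·pot 0 - growth A`, where `growth A = -(2π)² C₀(A)`. All terms are
positive there, so one term near the critical point already shows that the growth is exactly
`exp((growth A + o(1))/ε)`.

Near a primitive `c`-th root of unity, multiplying the factors of a `q`-factorial over a period
gives `∏ (1 - ζ^j t) = 1 - t^c`. Up to a bounded factor it is bounded below by a real `q`-factorial
with `c²ε` in place of `ε` and `n/c` in place of `n`. Summing absolute values gives only an upper
bound, `exp((growth A/c² + o(1))/ε)`, since the phases may cancel. On a vertical line tending to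
`i∞`, `γ` maps to the ray above `a/c` with `ε = 2π/(c²y)`. The two factors `c²` cancel, and every
rational cusp yields the same bound `v ≥ C₀(A)`, with equality at `0`.

Modularity supplies the Fourier expansions: it makes `f ∘ γ` periodic, and the crude uniform bound
`exp(G/ε)` near the real line allows at most a pole in `q^{1/h}`. The cusp `∞` is replaced by a
rational cusp equivalent to it under the finite index subgroup. The main estimates are
`exists_le_norm_qFactorial`, `potential_critPoint_le`, `exists_norm_nahmFun_le`,
`eventually_le_norm_nahmFun` and `exists_isOrderAtInfty`. -/

lemma pot_zero : pot 0 = Real.pi ^ 2 / 6 := by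
  have h := (hasSum_nat_add_iff' 1).2 hasSum_zeta_two
  simp only [Finset.range_one, Finset.sum_singleton, Nat.cast_zero, ne_eq, OfNat.ofNat_ne_zero,
    not_false_eq_true, zero_pow, div_zero, sub_zero, Nat.cast_add, Nat.cast_one] at h
  simpa [pot, Li2] using h.tsum_eq

lemma exp_neg_lt_one {x : ℝ} (hx : 0 < x) : Real.exp (-x) < 1 :=
  Real.exp_lt_one_iff.mpr (by linarith)

lemma log_one_sub_exp_neg_le {a b : ℝ} (ha : 0 < a) (hab : a ≤ b) :
    Real.log (1 - Real.exp (-a)) ≤ Real.log (1 - Real.exp (-b)) := by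
  have h1 := exp_neg_lt_one ha
  have h2 : Real.exp (-b) ≤ Real.exp (-a) := Real.exp_le_exp.2 (by linarith)
  exact Real.log_le_log (by linarith) (by linarith)

/-- The mean value theorem needs only continuity at the endpoints, so `x = 0` is allowed although
the slope of `pot` is infinite there. -/
lemma exists_pot_slope {x y : ℝ} (hx : 0 ≤ x) (hxy : x < y) :
    ∃ s, x < s ∧ s < y ∧ pot y - pot x = (y - x) * Real.log (1 - Real.exp (-s)) := by
  obtain ⟨s, hs, hse⟩ := exists_hasDerivAt_eq_slope pot
    (fun s => Real.log (1 - Real.exp (-s))) hxy pot_continuous.continuousOn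
    (fun z hz => hasDerivAt_pot (by linarith [hz.1]))
  refine ⟨s, hs.1, hs.2, ?_⟩
  rw [hse]
  field_simp [sub_ne_zero.2 hxy.ne']

/-- `pot` lies above its tangents. -/
lemma pot_tangent {a b : ℝ} (ha : 0 < a) (hb : 0 ≤ b) :
    (b - a) * Real.log (1 - Real.exp (-a)) ≤ pot b - pot a := by
  rcases lt_trichotomy a b with h | rfl | h
  · obtain ⟨s, h1, h2, h3⟩ := exists_pot_slope ha.le h
    rw [h3]
    exact mul_le_mul_of_nonneg_left (log_one_sub_exp_neg_le ha h1.le) (by linarith)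
  · simp
  · obtain ⟨s, h1, h2, h3⟩ := exists_pot_slope hb h
    have := mul_le_mul_of_nonneg_left (log_one_sub_exp_neg_le (by linarith) h2.le)
      (by linarith : 0 ≤ a - b)
    linarith

lemma pot_antitoneOn {a b : ℝ} (ha : 0 ≤ a) (hab : a ≤ b) : pot b ≤ pot a := by
  rcases hab.eq_or_lt with rfl | h
  · exact le_rfl
  · have hb : 0 < b := by linarith
    have h1 := pot_tangent hb ha
    have h2 : Real.log (1 - Real.exp (-b)) ≤ 0 :=
      Real.log_nonpos (by linarith [exp_neg_lt_one hb]) (by linarith [Real.exp_pos (-b)])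
    nlinarith [mul_nonneg_of_nonpos_of_nonpos (by linarith : a - b ≤ 0) h2]

/-! ### Positive definite quadratic forms -/

/-- The quadratic form of the matrix `A` at a real vector. -/
noncomputable def quadForm {N : ℕ} (A : Matrix (Fin N) (Fin N) ℚ) (u : Fin N → ℝ) : ℝ :=
  dotProduct u ((A.map (fun x : ℚ => (x : ℝ))).mulVec u)

lemma quadForm_smul {N : ℕ} (A : Matrix (Fin N) (Fin N) ℚ) (c : ℝ) (u : Fin N → ℝ) :
    quadForm A (c • u) = c ^ 2 * quadForm A u := by
  simp only [quadForm, Matrix.mulVec_smul, dotProduct_smul, smul_dotProduct, smul_eq_mul]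
  ring

lemma quadForm_continuous {N : ℕ} (A : Matrix (Fin N) (Fin N) ℚ) : Continuous (quadForm A) := by
  unfold quadForm
  simp only [dotProduct, Matrix.mulVec]
  fun_prop

lemma quadForm_nonneg {N : ℕ} {A : Matrix (Fin N) (Fin N) ℚ} (hA : IsPosDef A) (u : Fin N → ℝ) :
    0 ≤ quadForm A u := by
  simpa [quadForm] using hA.posSemidef.dotProduct_mulVec_nonneg u

lemma exists_quadForm_lower_bound {N : ℕ} {A : Matrix (Fin N) (Fin N) ℚ} (hA : IsPosDef A) :
    ∃ c : ℝ, 0 < c ∧ ∀ u : Fin N → ℝ, c * ‖u‖ ^ 2 ≤ quadForm A u := by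
  have hzero : quadForm A 0 = 0 := by simp [quadForm]
  rcases (Metric.sphere (0 : Fin N → ℝ) 1).eq_empty_or_nonempty with hE | hE
  · refine ⟨1, one_pos, fun u => ?_⟩
    by_cases hu : u = 0
    · simp [hu, hzero]
    · exfalso
      have : (‖u‖⁻¹ • u) ∈ Metric.sphere (0 : Fin N → ℝ) 1 := by
        simp [norm_smul, inv_mul_cancel₀ (norm_ne_zero_iff.2 hu)]
      rw [hE] at this
      exact this
  · obtain ⟨w, hw, hmin⟩ := (isCompact_sphere (0 : Fin N → ℝ) 1).exists_isMinOn hE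
      (quadForm_continuous A).continuousOn
    have hw0 : w ≠ 0 := by
      rintro rfl
      simp at hw
    refine ⟨quadForm A w, by simpa [quadForm] using hA.dotProduct_mulVec_pos hw0, fun u => ?_⟩
    by_cases hu : u = 0
    · simp [hu, hzero]
    · have hn : ‖u‖ ≠ 0 := norm_ne_zero_iff.2 hu
      have hm : (‖u‖⁻¹ • u) ∈ Metric.sphere (0 : Fin N → ℝ) 1 := by
        simp [norm_smul, inv_mul_cancel₀ hn]
      have h : quadForm A w ≤ quadForm A (‖u‖⁻¹ • u) := hmin hm
      rw [quadForm_smul] at h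
      calc _ ≤ (‖u‖⁻¹ ^ 2 * quadForm A u) * ‖u‖ ^ 2 := by gcongr
        _ = _ := by field_simp

lemma quad_eq {N : ℕ} (A : Matrix (Fin N) (Fin N) ℚ) (B : Fin N → ℚ) (C : ℚ) (n : Fin N → ℕ) :
    ((quad A B C n : ℚ) : ℝ) =
      1 / 2 * quadForm A (fun i => (n i : ℝ)) + (∑ i, (B i : ℝ) * n i) + C := by
  simp [quad, quadForm, dotProduct, Matrix.mulVec, Finset.mul_sum, mul_assoc]

/-- Up to a constant, `Q(n)` exceeds `(1 - δ)/2 · nᵗAn` by at least the sum of the `n_i`. -/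
lemma exists_quad_lower_bound {N : ℕ} {A : Matrix (Fin N) (Fin N) ℚ} (hA : IsPosDef A)
    (B : Fin N → ℚ) (C : ℚ) {δ : ℝ} (hδ : 0 < δ) :
    ∃ K : ℝ, 0 ≤ K ∧ ∀ n : Fin N → ℕ,
      (1 - δ) / 2 * quadForm A (fun i => (n i : ℝ)) + (∑ i, (n i : ℝ)) - K
        ≤ ((quad A B C n : ℚ) : ℝ) := by
  obtain ⟨c, hc, hle⟩ := exists_quadForm_lower_bound hA
  -- The summand `1` pays for the term `∑ n_i` on the left, which later makes the series converge
  -- geometrically.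
  set b : ℝ := ∑ i, (1 + |(B i : ℝ)|) with hb
  -- The linear part is at most `b‖n‖`; completing the square against `(δ/2)·c‖n‖²` costs
  -- `b²/(2δc)`.
  refine ⟨b ^ 2 / (2 * (δ * c)) + |(C : ℝ)|, by positivity, fun n => ?_⟩
  have h1 := hle fun i => (n i : ℝ)
  set x : ℝ := ‖fun i => (n i : ℝ)‖ with hx
  have hx0 : 0 ≤ x := norm_nonneg _
  have h2 : (∑ i, (n i : ℝ)) - ∑ i, (B i : ℝ) * n i ≤ b * x := by
    rw [hb, Finset.sum_mul, ← Finset.sum_sub_distrib]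
    refine Finset.sum_le_sum fun i _ => ?_
    have hni : (n i : ℝ) ≤ x := by
      have := norm_le_pi_norm (fun i => (n i : ℝ)) i
      simpa using this
    have hB := neg_abs_le (B i : ℝ)
    have hn0 : (0 : ℝ) ≤ n i := Nat.cast_nonneg _
    nlinarith [mul_le_mul_of_nonneg_left hni (by positivity : 0 ≤ 1 + |(B i : ℝ)|),
      mul_le_mul_of_nonneg_right hB hn0]
  have h3 : b * x ≤ δ / 2 * (c * x ^ 2) + b ^ 2 / (2 * (δ * c)) := by
    have : δ / 2 * (c * x ^ 2) + b ^ 2 / (2 * (δ * c)) - b * x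
        = (δ * c * x - b) ^ 2 / (2 * (δ * c)) := by
      field_simp
      ring
    have h4 : 0 ≤ (δ * c * x - b) ^ 2 / (2 * (δ * c)) := by positivity
    linarith
  have h5 := mul_le_mul_of_nonneg_left h1 (by linarith : 0 ≤ δ / 2)
  rw [quad_eq]
  linarith [neg_abs_le (C : ℝ)]

/-! ### The minimum of the potential -/

/-- The potential whose critical point is the solution of the Nahm equation. -/
noncomputable def potential {N : ℕ} (A : Matrix (Fin N) (Fin N) ℚ) (u : Fin N → ℝ) : ℝ :=
  1 / 2 * quadForm A u + ∑ i, pot (u i)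

/-- The growth exponent `-(2π)² C₀(A)`. -/
noncomputable def growth {N : ℕ} (A : Matrix (Fin N) (Fin N) ℚ) : ℝ := -((2 * Real.pi) ^ 2 * C0 A)

/-- The solution of the Nahm equation in the coordinates `u = -log X`. -/
noncomputable def critPoint {N : ℕ} (A : Matrix (Fin N) (Fin N) ℚ) (i : Fin N) : ℝ :=
  -Real.log (nahmSolution A i)

lemma critPoint_pos {N : ℕ} {A : Matrix (Fin N) (Fin N) ℚ} (hA : IsPosDef A) (i : Fin N) :
    0 < critPoint A i := by
  have h := (nahmSolution_spec A hA).1 i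
  exact neg_pos.2 (Real.log_neg h.1 h.2)

lemma exp_neg_critPoint {N : ℕ} {A : Matrix (Fin N) (Fin N) ℚ} (hA : IsPosDef A) (i : Fin N) :
    Real.exp (-critPoint A i) = nahmSolution A i := by
  rw [critPoint, neg_neg, Real.exp_log ((nahmSolution_spec A hA).1 i).1]

lemma mulVec_critPoint {N : ℕ} {A : Matrix (Fin N) (Fin N) ℚ} (hA : IsPosDef A) (i : Fin N) :
    (A.map (fun x : ℚ => (x : ℝ))).mulVec (critPoint A) i
      = -Real.log (1 - Real.exp (-critPoint A i)) := by
  have h := (isNahmSolution_iff A _ (nahmSolution_spec A hA).1).1 (nahmSolution_spec A hA) i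
  rw [exp_neg_critPoint hA]
  exact eq_neg_of_add_eq_zero_left h

/-- By the Nahm equation the quadratic form becomes `∑ log X_i log(1 - X_i)`. This is exactly the
logarithmic part of the Rogers dilogarithm, and the constants `π²/6` are `pot 0`. -/
lemma potential_critPoint {N : ℕ} {A : Matrix (Fin N) (Fin N) ℚ} (hA : IsPosDef A) :
    potential A (critPoint A) = N * pot 0 - growth A := by
  have h1 : quadForm A (critPoint A) =
      ∑ i, Real.log (nahmSolution A i) * Real.log (1 - nahmSolution A i) := by
    rw [quadForm, dotProduct]
    refine Finset.sum_congr rfl fun i _ => ?_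
    rw [mulVec_critPoint hA, exp_neg_critPoint hA, critPoint]
    ring
  have h2 : ∀ i, pot (critPoint A i) = Li2 (nahmSolution A i) := fun i => by
    rw [pot, abs_of_pos (critPoint_pos hA i), exp_neg_critPoint hA]
  have h3 : growth A = -∑ i, rogersL (nahmSolution A i) := by
    rw [growth, C0]
    field_simp
  rw [h3, potential, h1, pot_zero]
  simp only [h2, rogersL, Finset.sum_sub_distrib, Finset.sum_add_distrib, Finset.mul_sum]
  simp [mul_assoc, add_comm]

/-- The critical point is the minimum of the potential on the nonnegative orthant. -/
lemma potential_critPoint_le {N : ℕ} {A : Matrix (Fin N) (Fin N) ℚ} (hA : IsPosDef A)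
    {u : Fin N → ℝ} (hu : ∀ i, 0 ≤ u i) : potential A (critPoint A) ≤ potential A u := by
  set M := A.map (fun x : ℚ => (x : ℝ)) with hM
  set v := critPoint A with hv
  have hsym : dotProduct v (M.mulVec u) = dotProduct u (M.mulVec v) := by
    have hT : M.transpose = M := by simpa using hA.1.eq
    rw [Matrix.dotProduct_mulVec, ← Matrix.mulVec_transpose, hT, dotProduct_comm]
  -- Second-order expansion at the critical point: the linear term is cancelled by the tangents of
  -- `pot`, and both remainders are nonnegative by convexity.
  have h1 : quadForm A u - quadForm A v = quadForm A (u - v) + 2 * dotProduct (u - v) (M.mulVec v) := by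
    simp only [quadForm, ← hM, Matrix.mulVec_sub, dotProduct_sub, sub_dotProduct, hsym]
    ring
  have h2 := quadForm_nonneg hA (u - v)
  have h3 : -dotProduct (u - v) (M.mulVec v) ≤ ∑ i, (pot (u i) - pot (v i)) := by
    rw [dotProduct, ← Finset.sum_neg_distrib]
    refine Finset.sum_le_sum fun i _ => ?_
    have := pot_tangent (critPoint_pos hA i) (hu i)
    rw [hM, hv, mulVec_critPoint hA]
    simp only [Pi.sub_apply]
    linarith
  rw [Finset.sum_sub_distrib] at h3
  unfold potential
  linarith

/-! ### Geometric series in several variables -/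

lemma hasSum_prod_pow {x : ℝ} (hx0 : 0 ≤ x) (hx1 : x < 1) (N : ℕ) :
    HasSum (fun n : Fin N → ℕ => ∏ i, x ^ n i) ((1 - x)⁻¹ ^ N) := by
  induction N with
  | zero => simp
  | succ N ih =>
    have h1 := hasSum_geometric_of_lt_one hx0 hx1
    have hx : (0 : ℕ → ℝ) ≤ fun k => x ^ k := fun k => pow_nonneg hx0 k
    have hn : (0 : (Fin N → ℕ) → ℝ) ≤ fun n => ∏ i, x ^ n i :=
      fun n => Finset.prod_nonneg fun i _ => pow_nonneg hx0 (n i)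
    have hs := h1.summable.mul_of_nonneg ih.summable hx hn
    have h2 := h1.mul ih hs
    rw [pow_succ', ← (Fin.consEquiv fun _ => ℕ).hasSum_iff]
    refine h2.congr_fun fun p => ?_
    rw [Function.comp_apply, Fin.prod_univ_succ]
    rfl

/-! ### Estimates of `q`-factorials -/

/-- The tangent at `(n+1)ε` evaluated at `nε` bounds each factor from below by an increment of
`pot`, and the increments telescope. -/
lemma le_prod_one_sub_pow {ε : ℝ} (hε : 0 < ε) (n : ℕ) :
    Real.exp (-((pot 0 - pot (n * ε)) / ε)) ≤
      ∏ k ∈ Finset.range n, (1 - Real.exp (-ε) ^ (k + 1)) := by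
  induction n with
  | zero => simp
  | succ n ih =>
    have hk : 0 < ((n : ℝ) + 1) * ε := by positivity
    have h1 := pot_tangent hk (by positivity : 0 ≤ (n : ℝ) * ε)
    have h2 : Real.exp (-ε) ^ (n + 1) = Real.exp (-(((n : ℝ) + 1) * ε)) := by
      rw [← Real.exp_nat_mul]
      push_cast
      ring_nf
    have h3 : 0 < 1 - Real.exp (-(((n : ℝ) + 1) * ε)) := by linarith [exp_neg_lt_one hk]
    have h4 : Real.exp ((pot ((n + 1 : ℝ) * ε) - pot (n * ε)) / ε)
        ≤ 1 - Real.exp (-(((n : ℝ) + 1) * ε)) := by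
      rw [← Real.le_log_iff_exp_le h3, div_le_iff₀ hε]
      linarith
    rw [Finset.prod_range_succ, h2]
    calc _ = Real.exp (-((pot 0 - pot (n * ε)) / ε)) *
          Real.exp ((pot ((n + 1 : ℝ) * ε) - pot (n * ε)) / ε) := by
          rw [← Real.exp_add]
          push_cast
          ring_nf
      _ ≤ _ := mul_le_mul ih h4 (Real.exp_pos _).le ((Real.exp_pos _).le.trans ih)

/-- The same tangent, evaluated one step to the right, gives the opposite bound; hence the shift
from `[0, nε]` to `[ε, (n+1)ε]`. -/
lemma prod_one_sub_pow_le {ε : ℝ} (hε : 0 < ε) (n : ℕ) :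
    ∏ k ∈ Finset.range n, (1 - Real.exp (-ε) ^ (k + 1)) ≤
      Real.exp (-((pot ε - pot ((n + 1) * ε)) / ε)) := by
  induction n with
  | zero => simp
  | succ n ih =>
    have hk : 0 < ((n : ℝ) + 1) * ε := by positivity
    have h1 := pot_tangent hk (by positivity : 0 ≤ ((n : ℝ) + 1 + 1) * ε)
    have h2 : Real.exp (-ε) ^ (n + 1) = Real.exp (-(((n : ℝ) + 1) * ε)) := by
      rw [← Real.exp_nat_mul]
      push_cast
      ring_nf
    have h3 : 0 < 1 - Real.exp (-(((n : ℝ) + 1) * ε)) := by linarith [exp_neg_lt_one hk]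
    have h4 : 1 - Real.exp (-(((n : ℝ) + 1) * ε)) ≤
        Real.exp ((pot ((n + 1 + 1 : ℝ) * ε) - pot ((n + 1) * ε)) / ε) := by
      rw [← Real.log_le_iff_le_exp h3, le_div_iff₀ hε]
      linarith
    rw [Finset.prod_range_succ, h2]
    calc _ ≤ Real.exp (-((pot ε - pot ((n + 1) * ε)) / ε)) *
          Real.exp ((pot ((n + 1 + 1 : ℝ) * ε) - pot ((n + 1) * ε)) / ε) := by gcongr
      _ = _ := by
          rw [← Real.exp_add]
          push_cast
          ring_nf

/-! ### Complex `q`, and the approach to a root of unity -/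

lemma prod_le_norm_qFactorial {q : ℂ} (hq : ‖q‖ < 1) (n : ℕ) :
    ∏ k ∈ Finset.range n, (1 - ‖q‖ ^ (k + 1)) ≤ ‖qFactorial q n‖ := by
  rw [qFactorial, norm_prod]
  refine Finset.prod_le_prod (fun k _ => ?_) fun k _ => ?_
  · linarith [pow_le_one₀ (norm_nonneg q) hq.le (n := k + 1)]
  · have := norm_sub_norm_le (1 : ℂ) (q ^ (k + 1))
    simpa using this

/-- Either `s` is far from `1`, or `ωs` is close to `ω`: add the two triangle inequalities `h1` and
`h2`. -/
lemma half_norm_one_sub_le {ω : ℂ} (hω : ‖ω‖ = 1) {s : ℝ} (hs0 : 0 ≤ s) (hs1 : s ≤ 1) :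
    ‖1 - ω‖ / 2 ≤ ‖1 - ω * s‖ := by
  have h1 : 1 - s ≤ ‖1 - ω * s‖ := by
    have := norm_sub_norm_le (1 : ℂ) (ω * s)
    rw [norm_mul, hω, Complex.norm_real, Real.norm_of_nonneg hs0] at this
    simpa using this
  have h2 : ‖1 - ω‖ ≤ ‖1 - ω * s‖ + (1 - s) := by
    have h3 : 1 - ω = (1 - ω * s) - ω * ((1 - s : ℝ) : ℂ) := by push_cast; ring
    calc ‖1 - ω‖ ≤ ‖1 - ω * s‖ + ‖ω * ((1 - s : ℝ) : ℂ)‖ := by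
          rw [h3]; exact norm_sub_le _ _
      _ = _ := by rw [norm_mul, hω, Complex.norm_real, Real.norm_of_nonneg (by linarith), one_mul]
  linarith

lemma exists_le_norm_one_sub {ζ : ℂ} {c : ℕ} (hc : 0 < c) (hζ : IsPrimitiveRoot ζ c) :
    ∃ κ : ℝ, 0 < κ ∧ κ ≤ 1 ∧ ∀ j : ℕ, ¬ c ∣ j → ∀ s : ℝ, 0 ≤ s → s ≤ 1 →
      κ ≤ ‖1 - ζ ^ j * s‖ := by
  have key : ∀ S : Finset ℕ, (∀ j ∈ S, ¬ c ∣ j) →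
      ∃ κ : ℝ, 0 < κ ∧ κ ≤ 1 ∧ ∀ j ∈ S, κ ≤ ‖1 - ζ ^ j‖ / 2 := by
    intro S
    induction S using Finset.induction_on with
    | empty => exact fun _ => ⟨1, one_pos, le_rfl, by simp⟩
    | insert a S _ ih =>
      intro h
      obtain ⟨κ, h0, h1, h2⟩ := ih fun j hj => h j (Finset.mem_insert_of_mem hj)
      have ha : 0 < ‖1 - ζ ^ a‖ / 2 := by
        have : 1 - ζ ^ a ≠ 0 := sub_ne_zero.2 fun h' =>
          h a (Finset.mem_insert_self _ _) (hζ.dvd_of_pow_eq_one _ h'.symm)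
        positivity
      refine ⟨min κ (‖1 - ζ ^ a‖ / 2), lt_min h0 ha, (min_le_left _ _).trans h1, fun j hj => ?_⟩
      rcases Finset.mem_insert.1 hj with rfl | hj
      · exact min_le_right _ _
      · exact (min_le_left _ _).trans (h2 j hj)
  obtain ⟨κ, h0, h1, h2⟩ := key ((Finset.range c).filter fun j => ¬ c ∣ j)
    fun j hj => (Finset.mem_filter.1 hj).2
  refine ⟨κ, h0, h1, fun j hj s hs0 hs1 => ?_⟩
  have hm : ¬ c ∣ j % c := fun h => hj ((Nat.dvd_mod_iff dvd_rfl).1 h)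
  have hn : ‖ζ‖ = 1 := hζ.norm'_eq_one hc.ne'
  have := half_norm_one_sub_le (ω := ζ ^ j) (by simp [hn]) hs0 hs1
  refine le_trans ?_ this
  rw [pow_eq_pow_mod j hζ.pow_eq_one]
  exact h2 _ (Finset.mem_filter.2 ⟨Finset.mem_range.2 (Nat.mod_lt _ hc), hm⟩)

/-- Away from zero, an additive change of size `d` is a multiplicative change of at most `e^{d/κ}`.
-/
lemma norm_one_sub_mul_exp_le {ω : ℂ} (hω : ‖ω‖ = 1) {s t κ d : ℝ} (hκ : 0 < κ)
    (hst : t ≤ s) (hd : s - t ≤ d) (h : κ ≤ ‖1 - ω * s‖) :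
    ‖1 - ω * t‖ * Real.exp (-(d / κ)) ≤ ‖1 - ω * s‖ := by
  have h1 : ‖1 - ω * t‖ ≤ ‖1 - ω * s‖ + (s - t) := by
    have h3 : 1 - ω * t = (1 - ω * s) + ω * ((s - t : ℝ) : ℂ) := by push_cast; ring
    calc ‖1 - ω * t‖ ≤ ‖1 - ω * s‖ + ‖ω * ((s - t : ℝ) : ℂ)‖ := by
          rw [h3]; exact norm_add_le _ _
      _ = _ := by rw [norm_mul, hω, Complex.norm_real, Real.norm_of_nonneg (by linarith), one_mul]
  have h2 : ‖1 - ω * t‖ ≤ ‖1 - ω * s‖ * Real.exp (d / κ) := by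
    have h4 := Real.add_one_le_exp (d / κ)
    have h5 : d ≤ ‖1 - ω * s‖ * (d / κ) := by
      rw [mul_div_assoc', le_div_iff₀ hκ]
      nlinarith
    nlinarith [mul_le_mul_of_nonneg_left h4 (norm_nonneg (1 - ω * s))]
  rw [Real.exp_neg, ← div_eq_mul_inv, div_le_iff₀ (Real.exp_pos _)]
  exact h2

lemma prod_one_sub_root_mul {ζ : ℂ} {c : ℕ} (hc : 0 < c) (hζ : IsPrimitiveRoot ζ c) (x : ℂ) :
    ∏ j ∈ Finset.range c, (1 - ζ ^ (j + 1) * x) = 1 - x ^ c := by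
  have h1 : ∏ j ∈ Finset.range c, (1 - ζ ^ (j + 1) * x) = ∏ j ∈ Finset.range c, (1 - ζ ^ j * x) := by
    obtain ⟨d, rfl⟩ := Nat.exists_eq_succ_of_ne_zero hc.ne'
    rw [Finset.prod_range_succ, Finset.prod_range_succ' (fun j => 1 - ζ ^ j * x), hζ.pow_eq_one,
      pow_zero]
  rw [h1, ← one_pow c, hζ.pow_sub_pow_eq_prod_sub_mul _ _ hc, one_pow]
  refine Finset.prod_bij (fun j _ => ζ ^ j) (fun j _ => ?_) (fun i hi j hj h => ?_)
    (fun ω hω => ?_) fun _ _ => rfl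
  · rw [Polynomial.mem_nthRootsFinset hc, ← pow_mul, mul_comm, pow_mul, hζ.pow_eq_one, one_pow]
  · exact hζ.pow_inj (Finset.mem_range.1 hi) (Finset.mem_range.1 hj) h
  · have : NeZero c := ⟨hc.ne'⟩
    obtain ⟨i, hi, h⟩ := hζ.eq_pow_of_pow_eq_one ((Polynomial.mem_nthRootsFinset hc _).1 hω)
    exact ⟨i, Finset.mem_range.2 hi, h⟩

/-- The contribution of a full period of factors, near a root of unity. -/
lemma le_prod_period {ζ : ℂ} {c : ℕ} (hc : 0 < c) (hζ : IsPrimitiveRoot ζ c) {κ : ℝ} (hκ : 0 < κ)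
    (hle : ∀ j : ℕ, ¬ c ∣ j → ∀ s : ℝ, 0 ≤ s → s ≤ 1 → κ ≤ ‖1 - ζ ^ j * s‖)
    {r : ℝ} (hr0 : 0 < r) (hr1 : r < 1) (m : ℕ) :
    (1 - (r ^ (c ^ 2)) ^ (m + 1)) * Real.exp (-(c / κ * (r ^ (c * m) - r ^ (c * (m + 1))))) ≤
      ∏ j ∈ Finset.range c, ‖1 - (ζ * r) ^ (c * m + j + 1)‖ := by
  -- All radii in the period are moved to the last one. The factor with `ζ^{j+1} = 1`, the only one
  -- that can be small, already has this radius and loses nothing.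
  set t : ℝ := r ^ (c * (m + 1)) with ht
  have ht0 : 0 < t := by positivity
  have ht1 : t ≤ 1 := pow_le_one₀ hr0.le hr1.le
  have hn : ‖ζ‖ = 1 := hζ.norm'_eq_one hc.ne'
  set d : ℝ := r ^ (c * m) - t with hd
  have hd0 : 0 ≤ d := sub_nonneg.2 (pow_le_pow_of_le_one hr0.le hr1.le (by gcongr; omega))
  have h1 : (1 - (r ^ (c ^ 2)) ^ (m + 1)) = ∏ j ∈ Finset.range c, ‖1 - ζ ^ (j + 1) * t‖ := by
    rw [← norm_prod, prod_one_sub_root_mul hc hζ]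
    have h2 : t ^ c = (r ^ (c ^ 2)) ^ (m + 1) := by
      rw [ht, ← pow_mul, ← pow_mul]; ring_nf
    have h3 : (1 : ℂ) - (t : ℂ) ^ c = ((1 - t ^ c : ℝ) : ℂ) := by push_cast; rfl
    rw [h3, Complex.norm_real, Real.norm_of_nonneg (by linarith [pow_le_one₀ ht0.le ht1 (n := c)]),
      h2]
  have h2 : Real.exp (-(c / κ * d)) = ∏ j ∈ Finset.range c, Real.exp (-(d / κ)) := by
    rw [Finset.prod_const, Finset.card_range, ← Real.exp_nat_mul]
    ring_nf
  rw [h1, h2, ← Finset.prod_mul_distrib]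
  refine Finset.prod_le_prod (fun _ _ => by positivity) fun j hj => ?_
  have hj := Finset.mem_range.1 hj
  have h4 : (ζ * r) ^ (c * m + j + 1) = ζ ^ (j + 1) * ((r ^ (c * m + j + 1) : ℝ) : ℂ) := by
    rw [mul_pow, add_assoc, pow_add ζ, pow_mul, hζ.pow_eq_one, one_pow, one_mul]
    push_cast
    rfl
  rw [h4]
  by_cases hdvd : c ∣ j + 1
  · have hjc : j + 1 = c := le_antisymm hj (Nat.le_of_dvd (by omega) hdvd)
    have : c * m + j + 1 = c * (m + 1) := by rw [add_assoc, hjc]; ring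
    rw [this, ← ht]
    refine mul_le_of_le_one_right (norm_nonneg _) (Real.exp_le_one_iff.2 ?_)
    have : 0 ≤ d / κ := by positivity
    linarith
  · refine norm_one_sub_mul_exp_le (by simp [hn]) hκ ?_ ?_
      (hle _ hdvd _ (by positivity) (pow_le_one₀ hr0.le hr1.le))
    · refine pow_le_pow_of_le_one hr0.le hr1.le ?_
      have : c * (m + 1) = c * m + c := by ring
      omega
    · exact sub_le_sub_right (pow_le_pow_of_le_one hr0.le hr1.le (by omega)) _

/-- The errors of the successive periods telescope in `r^{cm}`, so their total stays bounded by
`c/κ` however many periods occur. -/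
lemma le_norm_qFactorial_mul {ζ : ℂ} {c : ℕ} (hc : 0 < c) (hζ : IsPrimitiveRoot ζ c) {κ : ℝ}
    (hκ : 0 < κ) (hle : ∀ j : ℕ, ¬ c ∣ j → ∀ s : ℝ, 0 ≤ s → s ≤ 1 → κ ≤ ‖1 - ζ ^ j * s‖)
    {r : ℝ} (hr0 : 0 < r) (hr1 : r < 1) (M : ℕ) :
    (∏ m ∈ Finset.range M, (1 - (r ^ (c ^ 2)) ^ (m + 1))) *
      Real.exp (-(c / κ * (1 - r ^ (c * M)))) ≤ ‖qFactorial (ζ * r) (c * M)‖ := by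
  induction M with
  | zero => simp [qFactorial]
  | succ M ih =>
    have h1 := le_prod_period hc hζ hκ hle hr0 hr1 M
    have h2 : ‖qFactorial (ζ * r) (c * (M + 1))‖ = ‖qFactorial (ζ * r) (c * M)‖ *
        ∏ j ∈ Finset.range c, ‖1 - (ζ * r) ^ (c * M + j + 1)‖ := by
      rw [qFactorial, qFactorial, mul_add, mul_one, Finset.prod_range_add, norm_mul,
        ← norm_prod]
    have h3 : 0 ≤ 1 - (r ^ (c ^ 2)) ^ (M + 1) :=
      sub_nonneg.2 (pow_le_one₀ (by positivity) (pow_le_one₀ hr0.le hr1.le))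
    rw [h2]
    refine le_trans (le_of_eq ?_) (mul_le_mul ih h1 (mul_nonneg h3 (Real.exp_pos _).le)
      (norm_nonneg _))
    have h4 : Real.exp (-(c / κ * (1 - r ^ (c * (M + 1))))) =
        Real.exp (-(c / κ * (1 - r ^ (c * M)))) *
          Real.exp (-(c / κ * (r ^ (c * M) - r ^ (c * (M + 1))))) := by
      rw [← Real.exp_add]
      ring_nf
    rw [Finset.prod_range_succ, h4]
    ring

/-- Lower bound for `q`-factorials along the ray to a primitive `c`-th root of unity. -/
lemma exists_le_norm_qFactorial {ζ : ℂ} {c : ℕ} (hc : 0 < c) (hζ : IsPrimitiveRoot ζ c) :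
    ∃ D : ℝ, ∀ ε : ℝ, 0 < ε → ∀ n : ℕ,
      Real.exp (-(D + (pot 0 - pot (c * ε * n)) / (c ^ 2 * ε))) ≤
        ‖qFactorial (ζ * (Real.exp (-ε) : ℝ)) n‖ := by
  obtain ⟨κ, hκ, hκ1, hle⟩ := exists_le_norm_one_sub hc hζ
  -- The first part is the total error of the full periods; the second is the fewer than `c`
  -- leftover factors, each at least `κ`.
  refine ⟨c / κ - c * Real.log κ, fun ε hε n => ?_⟩
  set r := Real.exp (-ε) with hr
  have hr0 : 0 < r := Real.exp_pos _
  have hr1 : r < 1 := exp_neg_lt_one hε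
  set M := n / c with hM
  have hcM : c * M ≤ n := Nat.mul_div_le n c
  obtain ⟨j, hj⟩ := Nat.exists_eq_add_of_le hcM
  have hjc : j < c := by
    have : c * M + n % c = n := Nat.div_add_mod n c
    have := Nat.mod_lt n hc
    omega
  have h1 := le_norm_qFactorial_mul hc hζ hκ hle hr0 hr1 M
  have hc0 : (0 : ℝ) < c := by exact_mod_cast hc
  have h2 := le_prod_one_sub_pow (by positivity : 0 < (c : ℝ) ^ 2 * ε) M
  have h3 : Real.exp (-((c : ℝ) ^ 2 * ε)) = r ^ (c ^ 2) := by
    rw [hr, ← Real.exp_nat_mul]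
    push_cast
    ring_nf
  rw [h3] at h2
  have h4 : pot (c * ε * n) ≤ pot (M * (c ^ 2 * ε)) := by
    refine pot_antitoneOn (by positivity) ?_
    have : ((c * M : ℕ) : ℝ) ≤ n := by exact_mod_cast hcM
    push_cast at this
    nlinarith [mul_le_mul_of_nonneg_left this (by positivity : 0 ≤ c * ε)]
  have h5 : ‖qFactorial (ζ * r) n‖ = ‖qFactorial (ζ * r) (c * M)‖ *
      ∏ i ∈ Finset.range j, ‖1 - (ζ * r) ^ (c * M + i + 1)‖ := by
    rw [qFactorial, qFactorial, hj, Finset.prod_range_add, norm_mul, ← norm_prod]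
  have h6 : κ ^ c ≤ ∏ i ∈ Finset.range j, ‖1 - (ζ * r) ^ (c * M + i + 1)‖ := by
    calc κ ^ c ≤ κ ^ j := pow_le_pow_of_le_one hκ.le hκ1 hjc.le
      _ = ∏ i ∈ Finset.range j, κ := by simp
      _ ≤ _ := by
        refine Finset.prod_le_prod (fun _ _ => hκ.le) fun i hi => ?_
        have hi := Finset.mem_range.1 hi
        have h := hle (c * M + i + 1) (by
          rw [add_assoc, Nat.dvd_add_right (dvd_mul_right _ _)]
          exact Nat.not_dvd_of_pos_of_lt (by omega) (by omega)) (r ^ (c * M + i + 1))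
          (by positivity) (pow_le_one₀ hr0.le hr1.le)
        rw [mul_pow]
        exact_mod_cast h
  have h7 : Real.exp (c * Real.log κ) = κ ^ c := by
    rw [Real.exp_nat_mul, Real.exp_log hκ]
  rw [h5]
  calc _ = Real.exp (-((pot 0 - pot (c * ε * n)) / (c ^ 2 * ε))) * Real.exp (-(c / κ)) * κ ^ c := by
        rw [← h7, ← Real.exp_add, ← Real.exp_add]
        ring_nf
    _ ≤ (∏ m ∈ Finset.range M, (1 - (r ^ (c ^ 2)) ^ (m + 1))) *
        Real.exp (-(c / κ * (1 - r ^ (c * M)))) * κ ^ c := by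
        have h8 : Real.exp (-((pot 0 - pot (c * ε * n)) / (c ^ 2 * ε))) ≤
            ∏ m ∈ Finset.range M, (1 - (r ^ (c ^ 2)) ^ (m + 1)) := by
          refine le_trans (Real.exp_le_exp.2 ?_) h2
          gcongr
        have h9 : Real.exp (-(c / κ)) ≤ Real.exp (-(c / κ * (1 - r ^ (c * M)))) := by
          refine Real.exp_le_exp.2 (neg_le_neg (mul_le_of_le_one_right (by positivity) ?_))
          have : 0 < r ^ (c * M) := by positivity
          linarith
        have h10 := (Real.exp_pos (-((pot 0 - pot (c * ε * n)) / (c ^ 2 * ε)))).le.trans h8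
        gcongr
    _ ≤ _ := by gcongr

/-! ### Estimates of Nahm sums -/

lemma norm_e (z : ℂ) : ‖e z‖ = Real.exp (-(2 * Real.pi * z.im)) := by
  rw [e, Complex.norm_exp]
  simp

lemma e_ne_zero (z : ℂ) : e z ≠ 0 := Complex.exp_ne_zero _

lemma e_add (z w : ℂ) : e (z + w) = e z * e w := by
  rw [e, e, e, ← Complex.exp_add]
  ring_nf

lemma e_intCast (k : ℤ) : e k = 1 := by
  rw [e, Complex.exp_eq_one_iff]
  exact ⟨k, by ring⟩

lemma differentiable_e : Differentiable ℂ e := by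
  unfold e
  fun_prop

lemma norm_e_lt_one {z : ℂ} (hz : 0 < z.im) : ‖e z‖ < 1 := by
  rw [norm_e]
  exact exp_neg_lt_one (by positivity)

/-- The terms of a Nahm sum, as functions of a complex variable. -/
noncomputable def nahmTerm {N : ℕ} (A : Matrix (Fin N) (Fin N) ℚ) (B : Fin N → ℚ) (C : ℚ) (z : ℂ)
    (n : Fin N → ℕ) : ℂ :=
  e ((quad A B C n : ℂ) * z) / ∏ i, qFactorial (e z) (n i)

/-- The Nahm sum as a function of a complex variable. -/
noncomputable def nahmFun {N : ℕ} (A : Matrix (Fin N) (Fin N) ℚ) (B : Fin N → ℚ) (C : ℚ) (z : ℂ) :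
    ℂ :=
  ∑' n : Fin N → ℕ, nahmTerm A B C z n

variable {N : ℕ} {A : Matrix (Fin N) (Fin N) ℚ}

lemma norm_nahmTerm (B : Fin N → ℚ) (C : ℚ) (z : ℂ) (n : Fin N → ℕ) :
    ‖nahmTerm A B C z n‖ = Real.exp (-(2 * Real.pi * z.im * (quad A B C n : ℝ))) /
      ∏ i, ‖qFactorial (e z) (n i)‖ := by
  rw [nahmTerm, norm_div, norm_prod, norm_e]
  congr 2
  simp
  ring

/-- Since `pot` is continuous at `0`, this makes the geometric series contribute only `exp(o(1)/ε)`.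
-/
lemma inv_one_sub_exp_neg_le {ε : ℝ} (hε : 0 < ε) :
    (1 - Real.exp (-ε))⁻¹ ≤ Real.exp ((pot 0 - pot ε) / ε) := by
  have h := le_prod_one_sub_pow hε 1
  simp only [Nat.cast_one, one_mul, Finset.range_one, Finset.prod_singleton, zero_add, pow_one,
    Real.exp_neg ((pot 0 - pot ε) / ε)] at h
  exact inv_le_of_inv_le₀ (Real.exp_pos _) h

lemma potential_nonneg (hA : IsPosDef A) (u : Fin N → ℝ) : 0 ≤ potential A u := by
  have h1 := quadForm_nonneg hA u
  have h2 : 0 ≤ ∑ i, pot (u i) := Finset.sum_nonneg fun i _ => pot_nonneg _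
  unfold potential
  positivity

/-- The bound on `q`-factorials enters as a hypothesis in `c` and `D`, so one estimate serves both
arbitrary points (`c = 1`, `D = 0`) and rays to roots of unity. `K` depends on none of them. -/
lemma exists_norm_nahmFun_le (hA : IsPosDef A) (B : Fin N → ℚ) (C : ℚ) {δ : ℝ} (hδ : 0 < δ)
    (hδ1 : δ ≤ 1) : ∃ K : ℝ, ∀ (z : ℂ) (ε : ℝ) (c : ℕ) (D : ℝ), 0 < ε → 2 * Real.pi * z.im = ε →
      0 < c → (∀ n : ℕ, Real.exp (-(D + (pot 0 - pot (c * ε * n)) / (c ^ 2 * ε))) ≤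
        ‖qFactorial (e z) n‖) →
      Summable (fun n => ‖nahmTerm A B C z n‖) ∧ ‖nahmFun A B C z‖ ≤
        Real.exp (N * D + ε * K + (growth A + δ * potential A (critPoint A)) / (c ^ 2 * ε)) *
          Real.exp ((pot 0 - pot ε) / ε) ^ N := by
  obtain ⟨K, -, hK⟩ := exists_quad_lower_bound hA B C hδ
  refine ⟨K, fun z ε c D hε hz hc h => ?_⟩
  have hc0 : (0 : ℝ) < c := by exact_mod_cast hc
  set E := growth A + δ * potential A (critPoint A) with hE
  have hx0 : 0 ≤ Real.exp (-ε) := (Real.exp_pos _).le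
  have hx1 := exp_neg_lt_one hε
  have hsum := (hasSum_prod_pow hx0 hx1 N).mul_left (Real.exp (N * D + ε * K + E / (c ^ 2 * ε)))
  have hle : ∀ n : Fin N → ℕ, ‖nahmTerm A B C z n‖ ≤
      Real.exp (N * D + ε * K + E / (c ^ 2 * ε)) * ∏ i, Real.exp (-ε) ^ n i := by
    intro n
    -- With this scaling `ε·nᵗAn` equals `quadForm A u / (c²ε)`, the same denominator as in the
    -- bound for the `q`-factorials.
    set u : Fin N → ℝ := (c * ε) • fun i => (n i : ℝ) with hu
    have hui : ∀ i, u i = c * ε * n i := fun i => rfl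
    have h1 : ∏ i, Real.exp (-(D + (pot 0 - pot (u i)) / (c ^ 2 * ε))) ≤
        ∏ i, ‖qFactorial (e z) (n i)‖ :=
      Finset.prod_le_prod (fun i _ => (Real.exp_pos _).le) fun i _ => h (n i)
    have h2 : ∏ i, Real.exp (-(D + (pot 0 - pot (u i)) / (c ^ 2 * ε))) =
        Real.exp (-(N * D + (N * pot 0 - ∑ i, pot (u i)) / (c ^ 2 * ε))) := by
      rw [← Real.exp_sum, Finset.sum_neg_distrib, Finset.sum_add_distrib, ← Finset.sum_div,
        Finset.sum_sub_distrib]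
      simp
    have h3 : ∏ i, Real.exp (-ε) ^ n i = Real.exp (-(ε * ∑ i, (n i : ℝ))) := by
      simp_rw [← Real.exp_nat_mul]
      rw [← Real.exp_sum, Finset.mul_sum, ← Finset.sum_neg_distrib]
      congr 1
      exact Finset.sum_congr rfl fun i _ => by ring
    rw [h2] at h1
    rw [norm_nahmTerm, hz, h3]
    refine (div_le_div_of_nonneg_left (Real.exp_pos _).le (Real.exp_pos _) h1).trans ?_
    rw [← Real.exp_sub, ← Real.exp_add]
    refine Real.exp_le_exp.2 ?_
    have h4 := mul_le_mul_of_nonneg_left (hK n) hε.le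
    have h5 : quadForm A u = (c * ε) ^ 2 * quadForm A fun i => (n i : ℝ) := quadForm_smul _ _ _
    have h6 : potential A (critPoint A) ≤ potential A u :=
      potential_critPoint_le hA fun i => by rw [hui]; positivity
    -- Minimality of the critical point is used with weight `1 - δ`; the missing share `δ` of the
    -- potential is the price for absorbing the linear terms of `Q`.
    have h7 : N * pot 0 - ∑ i, pot (u i) - (1 - δ) / 2 * quadForm A u ≤ E := by
      have h8 := mul_le_mul_of_nonneg_left h6 (by linarith : 0 ≤ 1 - δ)
      have h9 : 0 ≤ ∑ i, pot (u i) := Finset.sum_nonneg fun i _ => pot_nonneg _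
      have h10 := potential_critPoint hA
      have h11 : 0 ≤ δ * ∑ i, pot (u i) := by positivity
      rw [hE]
      unfold potential at h8 h10 ⊢
      linarith
    have h8 := div_le_div_of_nonneg_right h7 (by positivity : 0 ≤ (c : ℝ) ^ 2 * ε)
    have h9 : (N * pot 0 - ∑ i, pot (u i) - (1 - δ) / 2 * quadForm A u) / (c ^ 2 * ε) =
        (N * pot 0 - ∑ i, pot (u i)) / (c ^ 2 * ε) -
          ε * ((1 - δ) / 2 * quadForm A fun i => (n i : ℝ)) := by
      rw [h5]
      field_simp
    rw [h9] at h8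
    linarith
  have hs : Summable (fun n => ‖nahmTerm A B C z n‖) :=
    Summable.of_nonneg_of_le (fun _ => norm_nonneg _) hle hsum.summable
  refine ⟨hs, (norm_tsum_le_tsum_norm hs).trans ((hs.tsum_le_tsum hle hsum.summable).trans ?_)⟩
  rw [hsum.tsum_eq]
  have := inv_one_sub_exp_neg_le hε
  have h0 : 0 ≤ (1 - Real.exp (-ε))⁻¹ := inv_nonneg.2 (by linarith)
  gcongr

lemma exp_le_norm_qFactorial {z : ℂ} (hz : 0 < z.im) (n : ℕ) :
    Real.exp (-((pot 0 - pot (n * (2 * Real.pi * z.im))) / (2 * Real.pi * z.im))) ≤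
      ‖qFactorial (e z) n‖ := by
  have h1 := le_prod_one_sub_pow (by positivity : 0 < 2 * Real.pi * z.im) n
  have h2 := prod_le_norm_qFactorial (norm_e_lt_one hz) n
  rw [norm_e] at h2
  exact h1.trans h2

lemma summable_norm_nahmTerm (hA : IsPosDef A) (B : Fin N → ℚ) (C : ℚ) {z : ℂ} (hz : 0 < z.im) :
    Summable (fun n => ‖nahmTerm A B C z n‖) := by
  obtain ⟨K, hK⟩ := exists_norm_nahmFun_le hA B C one_pos le_rfl
  refine (hK z _ 1 0 (by positivity) rfl one_pos fun n => ?_).1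
  refine le_trans (le_of_eq ?_) (exp_le_norm_qFactorial hz n)
  simp [mul_comm]

/-- Upper bound for a Nahm sum at points tending to a cusp. -/
lemma eventually_norm_nahmFun_le (hA : IsPosDef A) (B : Fin N → ℚ) (C : ℚ) {c : ℕ} (hc : 0 < c)
    (D : ℝ) {η : ℝ} (hη : 0 < η) : ∀ᶠ ε in 𝓝[>] (0 : ℝ), ∀ z : ℂ, 2 * Real.pi * z.im = ε →
      (∀ n : ℕ, Real.exp (-(D + (pot 0 - pot (c * ε * n)) / (c ^ 2 * ε))) ≤
        ‖qFactorial (e z) n‖) →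
      ‖nahmFun A B C z‖ ≤ Real.exp ((growth A / c ^ 2 + η) / ε) := by
  have hc1 : (1 : ℝ) ≤ c := by exact_mod_cast hc
  set F := potential A (critPoint A) with hF
  have hF0 : 0 ≤ F := potential_nonneg hA _
  set δ : ℝ := min 1 (η / (F + 1)) with hδ
  have hδ0 : 0 < δ := lt_min one_pos (by positivity)
  have hδF : δ * F < η := by
    have h1 : δ * (F + 1) ≤ η := by
      have := mul_le_mul_of_nonneg_right (min_le_right 1 (η / (F + 1))) (by linarith : 0 ≤ F + 1)
      rwa [div_mul_cancel₀ _ (by linarith)] at this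
    linarith
  obtain ⟨K, hK⟩ := exists_norm_nahmFun_le hA B C hδ0 (min_le_left _ _)
  -- `ε` times the exponent of the bound; it is continuous, so its value at `0` decides.
  set Φ : ℝ → ℝ := fun ε => ε * (N * D + ε * K) + (growth A + δ * F) / c ^ 2 +
    N * (pot 0 - pot ε) with hΦ
  have hcont : Continuous Φ := by
    have := pot_continuous
    fun_prop
  have h0 : Φ 0 < growth A / c ^ 2 + η := by
    have h1 : δ * F / c ^ 2 ≤ δ * F :=
      div_le_self (by positivity) (one_le_pow₀ hc1)
    simp only [hΦ, add_div]
    linarith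
  filter_upwards [((hcont.tendsto 0).mono_left nhdsWithin_le_nhds).eventually (gt_mem_nhds h0),
    self_mem_nhdsWithin] with ε hε hε0 z hz h
  have hε0 : 0 < ε := hε0
  refine (hK z ε c D hε0 hz hc h).2.trans ?_
  rw [← Real.exp_nat_mul, ← Real.exp_add]
  refine Real.exp_le_exp.2 (le_trans (le_of_eq ?_) (div_le_div_of_nonneg_right hε.le hε0.le))
  simp only [hΦ, hF]
  field_simp

/-- Upper bound for a Nahm sum along the vertical ray to a rational number. -/
lemma eventually_norm_nahmFun_le_of_isPrimitiveRoot (hA : IsPosDef A) (B : Fin N → ℚ) (C : ℚ)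
    {x : ℝ} {c : ℕ} (hc : 0 < c) (hx : IsPrimitiveRoot (e x) c) {η : ℝ} (hη : 0 < η) :
    ∀ᶠ ε in 𝓝[>] (0 : ℝ), ∀ z : ℂ, 2 * Real.pi * z.im = ε → z.re = x →
      ‖nahmFun A B C z‖ ≤ Real.exp ((growth A / c ^ 2 + η) / ε) := by
  obtain ⟨D, hD⟩ := exists_le_norm_qFactorial hc hx
  filter_upwards [eventually_norm_nahmFun_le hA B C hc D hη, self_mem_nhdsWithin]
    with ε h hε z hz hzx
  refine h z hz fun n => ?_
  have hq : e z = e x * (Real.exp (-ε) : ℝ) := by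
    have h1 : z = x + z.im * Complex.I := by rw [← hzx, Complex.re_add_im]
    have h2 : e (z.im * Complex.I) = (Real.exp (-ε) : ℝ) := by
      rw [e, ← hz, Complex.ofReal_exp]
      congr 1
      push_cast
      linear_combination (2 * Real.pi * z.im : ℂ) * Complex.I_mul_I
    rw [← h2, ← e_add, ← h1]
  rw [hq]
  exact hD ε hε n

/-- Uniform upper bound for a Nahm sum near the real line. -/
lemma exists_eventually_norm_nahmFun_le (hA : IsPosDef A) (B : Fin N → ℚ) (C : ℚ) :
    ∃ G : ℝ, 0 ≤ G ∧ ∀ᶠ ε in 𝓝[>] (0 : ℝ), ∀ z : ℂ, 2 * Real.pi * z.im = ε →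
      ‖nahmFun A B C z‖ ≤ Real.exp (G / ε) := by
  -- The real `q`-factorial is a lower bound for every argument of `q`, so `c = 1`, `D = 0`, `η = 1`
  -- work uniformly in the real part.
  refine ⟨|growth A| + 1, by positivity, ?_⟩
  filter_upwards [eventually_norm_nahmFun_le hA B C one_pos 0 one_pos, self_mem_nhdsWithin]
    with ε h hε z hz
  have hε : 0 < ε := hε
  have hz0 : 0 < z.im := by
    rw [← hz] at hε
    exact pos_of_mul_pos_right hε (by positivity)
  refine (h z hz fun n => ?_).trans (Real.exp_le_exp.2 ?_)
  · refine le_trans (le_of_eq ?_) (exp_le_norm_qFactorial hz0 n)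
    rw [hz]
    simp [mul_comm]
  · have := le_abs_self (growth A)
    simp only [Nat.cast_one, one_pow, div_one]
    gcongr

/-! ### Holomorphy -/

lemma qFactorial_ne_zero {q : ℂ} (hq : ‖q‖ < 1) (n : ℕ) : qFactorial q n ≠ 0 := by
  refine Finset.prod_ne_zero_iff.2 fun k _ => sub_ne_zero.2 fun h => ?_
  have h1 : ‖q ^ (k + 1)‖ < 1 := by
    rw [norm_pow]
    exact pow_lt_one₀ (norm_nonneg _) hq (by omega)
  rw [← h] at h1
  simp at h1

lemma differentiableAt_nahmTerm (B : Fin N → ℚ) (C : ℚ) {z : ℂ} (hz : 0 < z.im) (n : Fin N → ℕ) :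
    DifferentiableAt ℂ (fun w => nahmTerm A B C w n) z := by
  unfold nahmTerm
  have he := differentiable_e
  refine DifferentiableAt.div (by fun_prop) ?_
    (Finset.prod_ne_zero_iff.2 fun i _ => qFactorial_ne_zero (norm_e_lt_one hz) _)
  unfold qFactorial
  fun_prop

lemma differentiableAt_nahmFun (hA : IsPosDef A) (B : Fin N → ℚ) (C : ℚ) {z : ℂ} (hz : 0 < z.im) :
    DifferentiableAt ℂ (nahmFun A B C) z := by
  -- With `δ = 1` this reads `Q(n) ≥ ∑ n_i - K`, which gives a geometric majorant on horizontal
  -- strips.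
  obtain ⟨K, hK0, hK⟩ := exists_quad_lower_bound hA B C one_pos
  set a := z.im / 2 with ha
  set b := 2 * z.im with hb
  have ha0 : 0 < a := by positivity
  have hxa := exp_neg_lt_one (by positivity : 0 < 2 * Real.pi * a)
  have hU : IsOpen {w : ℂ | a < w.im ∧ w.im < b} :=
    (isOpen_lt continuous_const Complex.continuous_im).inter
      (isOpen_lt Complex.continuous_im continuous_const)
  have hsum := ((hasSum_prod_pow (Real.exp_pos _).le hxa N).mul_left
    (Real.exp (2 * Real.pi * b * K + N * (pot 0 / (2 * Real.pi * a))))).summable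
  have hd := Complex.differentiableOn_tsum_of_summable_norm hsum
    (F := fun n w => nahmTerm A B C w n)
    (fun n w hw => (differentiableAt_nahmTerm B C (ha0.trans hw.1) n).differentiableWithinAt) hU ?_
  · exact hd.differentiableAt (hU.mem_nhds ⟨by linarith, by linarith⟩)
  · intro n w hw
    have hw0 : 0 < w.im := ha0.trans hw.1
    have h1 : Real.exp (-(N * (pot 0 / (2 * Real.pi * a)))) ≤ ∏ i, ‖qFactorial (e w) (n i)‖ := by
      have h2 : Real.exp (-(N * (pot 0 / (2 * Real.pi * a)))) =
          ∏ i : Fin N, Real.exp (-(pot 0 / (2 * Real.pi * a))) := by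
        rw [Finset.prod_const, ← Real.exp_nat_mul]
        simp
      rw [h2]
      refine Finset.prod_le_prod (fun _ _ => (Real.exp_pos _).le) fun i _ =>
        le_trans (Real.exp_le_exp.2 (neg_le_neg ?_)) (exp_le_norm_qFactorial hw0 (n i))
      have h3 := pot_nonneg (n i * (2 * Real.pi * w.im))
      have h4 := pot_nonneg 0
      calc _ ≤ pot 0 / (2 * Real.pi * w.im) := by gcongr; linarith
        _ ≤ _ := by gcongr; exact hw.1.le
    have h3 : ∏ i, Real.exp (-(2 * Real.pi * a)) ^ n i =
        Real.exp (-(2 * Real.pi * a * ∑ i, (n i : ℝ))) := by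
      simp_rw [← Real.exp_nat_mul]
      rw [← Real.exp_sum, Finset.mul_sum, ← Finset.sum_neg_distrib]
      congr 1
      exact Finset.sum_congr rfl fun i _ => by ring
    rw [norm_nahmTerm, h3]
    refine (div_le_div_of_nonneg_left (Real.exp_pos _).le (Real.exp_pos _) h1).trans ?_
    rw [← Real.exp_sub, ← Real.exp_add]
    refine Real.exp_le_exp.2 ?_
    have h4 := mul_le_mul_of_nonneg_left (hK n) (by positivity : 0 ≤ 2 * Real.pi * w.im)
    have h5 : 0 ≤ ∑ i, (n i : ℝ) := by positivity
    have h6 : 2 * Real.pi * w.im * K ≤ 2 * Real.pi * b * K := by gcongr; exact hw.2.le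
    have h7 : 2 * Real.pi * a * ∑ i, (n i : ℝ) ≤ 2 * Real.pi * w.im * ∑ i, (n i : ℝ) := by
      gcongr; exact hw.1.le
    linarith

/-! ### The behaviour on the imaginary axis -/

lemma qFactorial_ofReal (r : ℝ) (n : ℕ) :
    qFactorial (r : ℂ) n = ((∏ k ∈ Finset.range n, (1 - r ^ (k + 1)) : ℝ) : ℂ) := by
  simp [qFactorial]

lemma e_mul_I (t : ℝ) : e (t * Complex.I) = (Real.exp (-(2 * Real.pi * t)) : ℝ) := by
  rw [e, Complex.ofReal_exp]
  congr 1
  push_cast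
  linear_combination (2 * Real.pi * t : ℂ) * Complex.I_mul_I

lemma prod_one_sub_pow_pos {r : ℝ} (hr0 : 0 ≤ r) (hr1 : r < 1) (n : ℕ) :
    0 < ∏ k ∈ Finset.range n, (1 - r ^ (k + 1)) :=
  Finset.prod_pos fun k _ => sub_pos.2 (pow_lt_one₀ hr0 hr1 (by omega))

lemma nahmTerm_mul_I (B : Fin N → ℚ) (C : ℚ) (t : ℝ) (n : Fin N → ℕ) :
    nahmTerm A B C (t * Complex.I) n = ((Real.exp (-(2 * Real.pi * t * (quad A B C n : ℝ))) /
      ∏ i, ∏ k ∈ Finset.range (n i), (1 - Real.exp (-(2 * Real.pi * t)) ^ (k + 1)) : ℝ) : ℂ) := by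
  have h1 : (quad A B C n : ℂ) * (t * Complex.I) = ((quad A B C n * t : ℝ) : ℂ) * Complex.I := by
    push_cast
    ring
  rw [nahmTerm, h1, e_mul_I, e_mul_I]
  simp only [qFactorial_ofReal]
  push_cast
  ring_nf

/-- On the imaginary axis every term is positive, so no cancellation occurs and any single term is a
lower bound. -/
lemma le_norm_nahmFun_mul_I (hA : IsPosDef A) (B : Fin N → ℚ) (C : ℚ) {t : ℝ} (ht : 0 < t)
    (n : Fin N → ℕ) : Real.exp (-(2 * Real.pi * t * (quad A B C n : ℝ))) /
      ∏ i, ∏ k ∈ Finset.range (n i), (1 - Real.exp (-(2 * Real.pi * t)) ^ (k + 1)) ≤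
        ‖nahmFun A B C (t * Complex.I)‖ := by
  set T : (Fin N → ℕ) → ℝ := fun n => Real.exp (-(2 * Real.pi * t * (quad A B C n : ℝ))) /
      ∏ i, ∏ k ∈ Finset.range (n i), (1 - Real.exp (-(2 * Real.pi * t)) ^ (k + 1)) with hT
  have hT0 : ∀ n, 0 ≤ T n := fun n => div_nonneg (Real.exp_pos _).le
    (Finset.prod_nonneg fun i _ => (prod_one_sub_pow_pos (Real.exp_pos _).le
      (exp_neg_lt_one (by positivity)) _).le)
  have hs : Summable T := by
    have := summable_norm_nahmTerm hA B C (z := t * Complex.I) (by simpa using ht)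
    refine this.congr fun n => ?_
    rw [nahmTerm_mul_I, Complex.norm_real, Real.norm_of_nonneg (hT0 n)]
  have h1 : nahmFun A B C (t * Complex.I) = ((∑' n, T n : ℝ) : ℂ) := by
    rw [nahmFun, Complex.ofReal_tsum]
    exact tsum_congr fun n => nahmTerm_mul_I B C t n
  rw [h1, Complex.norm_real]
  exact (hs.le_tsum n fun m _ => hT0 m).trans (le_abs_self _)

lemma nahmFun_mul_I_ne_zero (hA : IsPosDef A) (B : Fin N → ℚ) (C : ℚ) {t : ℝ} (ht : 0 < t) :
    nahmFun A B C (t * Complex.I) ≠ 0 := by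
  have h := le_norm_nahmFun_mul_I hA B C ht 0
  rw [← norm_pos_iff]
  refine lt_of_lt_of_le ?_ h
  simpa using Real.exp_pos _

/-- Lower bound for a Nahm sum on the imaginary axis. -/
lemma eventually_le_norm_nahmFun (hA : IsPosDef A) (B : Fin N → ℚ) (C : ℚ) {η : ℝ} (hη : 0 < η) :
    ∀ᶠ ε in 𝓝[>] (0 : ℝ), Real.exp ((growth A - η) / ε) ≤
      ‖nahmFun A B C ((ε / (2 * Real.pi) : ℝ) * Complex.I)‖ := by
  set u := critPoint A with hu
  -- The lattice point just below the saddle point, so that `εn` tends to the critical point.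
  set n : ℝ → Fin N → ℕ := fun ε i => ⌊u i / ε⌋₊ with hn
  have hid : Tendsto (fun ε : ℝ => ε) (𝓝[>] 0) (𝓝 0) := tendsto_id.mono_left nhdsWithin_le_nhds
  have hlim : ∀ i, Tendsto (fun ε : ℝ => ε * n ε i) (𝓝[>] 0) (𝓝 (u i)) := by
    intro i
    have h1 : Tendsto (fun ε : ℝ => u i - ε) (𝓝[>] 0) (𝓝 (u i)) := by
      simpa using tendsto_const_nhds.sub hid
    refine tendsto_of_tendsto_of_tendsto_of_le_of_le' h1 tendsto_const_nhds ?_ ?_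
    · filter_upwards [self_mem_nhdsWithin] with ε hε
      have hε : 0 < ε := hε
      have := Nat.lt_floor_add_one (u i / ε)
      rw [div_lt_iff₀ hε] at this
      simp only [hn]
      linarith
    · filter_upwards [self_mem_nhdsWithin] with ε hε
      have hε : 0 < ε := hε
      have := Nat.floor_le (div_nonneg (critPoint_pos hA i).le hε.le)
      rw [le_div_iff₀ hε] at this
      simp only [hn]
      linarith
  set Φ : ℝ → ℝ := fun ε => -(1 / 2 * quadForm A (fun i => ε * n ε i) +
    ε * (∑ i, (B i : ℝ) * (ε * n ε i)) + ε ^ 2 * C) +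
      ∑ i, (pot ε - pot (ε * n ε i + ε)) with hΦ
  have hΦlim : Tendsto Φ (𝓝[>] 0) (𝓝 (growth A)) := by
    have h1 : Tendsto (fun ε => quadForm A (fun i => ε * n ε i)) (𝓝[>] 0) (𝓝 (quadForm A u)) :=
      ((quadForm_continuous A).tendsto u).comp (tendsto_pi_nhds.2 hlim)
    have h2 : Tendsto (fun ε => ∑ i, (B i : ℝ) * (ε * n ε i)) (𝓝[>] 0)
        (𝓝 (∑ i, (B i : ℝ) * u i)) :=
      tendsto_finsetSum _ fun i _ => (hlim i).const_mul _
    have h3 : Tendsto (fun ε => ∑ i, (pot ε - pot (ε * n ε i + ε))) (𝓝[>] 0)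
        (𝓝 (∑ i, (pot 0 - pot (u i + 0)))) :=
      tendsto_finsetSum _ fun i _ => ((pot_continuous.tendsto 0).comp hid).sub
        ((pot_continuous.tendsto _).comp ((hlim i).add hid))
    have h4 := (((h1.const_mul (1 / 2)).add (hid.mul h2)).add
      ((hid.pow 2).mul_const (C : ℝ))).neg.add h3
    have h5 := potential_critPoint hA
    refine h4.trans_eq ?_
    congr 1
    simp only [add_zero, Finset.sum_sub_distrib, Finset.sum_const, Finset.card_univ,
      Fintype.card_fin, nsmul_eq_mul]
    unfold potential at h5
    linarith
  filter_upwards [hΦlim.eventually (lt_mem_nhds (by linarith : growth A - η < growth A)),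
    self_mem_nhdsWithin] with ε hε hε0
  have hε0 : 0 < ε := hε0
  have ht : 0 < ε / (2 * Real.pi) := by positivity
  refine le_trans ?_ (le_norm_nahmFun_mul_I hA B C ht (n ε))
  have h2 : 2 * Real.pi * (ε / (2 * Real.pi)) = ε := by field_simp
  rw [h2]
  have h3 : ∏ i, ∏ k ∈ Finset.range (n ε i), (1 - Real.exp (-ε) ^ (k + 1)) ≤
      Real.exp (-((∑ i, (pot ε - pot (ε * n ε i + ε))) / ε)) := by
    rw [Finset.sum_div, ← Finset.sum_neg_distrib, Real.exp_sum]
    refine Finset.prod_le_prod (fun i _ => (prod_one_sub_pow_pos (Real.exp_pos _).le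
      (exp_neg_lt_one hε0) _).le) fun i _ => ?_
    have := prod_one_sub_pow_le hε0 (n ε i)
    rwa [show ((n ε i : ℝ) + 1) * ε = ε * n ε i + ε by ring] at this
  have h4 : 0 < ∏ i, ∏ k ∈ Finset.range (n ε i), (1 - Real.exp (-ε) ^ (k + 1)) :=
    Finset.prod_pos fun i _ => prod_one_sub_pow_pos (Real.exp_pos _).le (exp_neg_lt_one hε0) _
  refine le_trans ?_ (div_le_div_of_nonneg_left (Real.exp_pos _).le h4 h3)
  rw [← Real.exp_sub]
  refine Real.exp_le_exp.2 ((div_le_div_of_nonneg_right hε.le hε0.le).trans (le_of_eq ?_))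
  have h5 : quadForm A (fun i => ε * n ε i) = ε ^ 2 * quadForm A fun i => (n ε i : ℝ) :=
    quadForm_smul A ε fun i => (n ε i : ℝ)
  have h6 : ∑ i, (B i : ℝ) * (ε * n ε i) = ε * ∑ i, (B i : ℝ) * n ε i := by
    rw [Finset.mul_sum]
    exact Finset.sum_congr rfl fun i _ => by ring
  simp only [hΦ]
  rw [quad_eq, h5, h6]
  field_simp
  ring

/-! ### Fourier expansions -/

lemma norm_e_real_mul (x : ℝ) (z : ℂ) : ‖e (x * z)‖ = Real.exp (-(2 * Real.pi * x * z.im)) := by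
  rw [norm_e]
  simp [mul_assoc]

lemma e_pow (z : ℂ) (n : ℕ) : e z ^ n = e (n * z) := by
  rw [e, e, ← Complex.exp_nat_mul]
  ring_nf

/-- A periodic holomorphic function on the upper half plane of moderate growth has a Fourier
expansion with a smallest exponent. -/
lemma exists_isOrderAtInfty {g : ℍ → ℂ} {h : ℕ} (hh : 0 < h) (hper : ∀ τ : ℍ, g ((h : ℝ) +ᵥ τ) = g τ)
    (hol : ∀ z : ℂ, 0 < z.im → DifferentiableAt ℂ (fun w => g (ofComplex w)) z) {K : ℝ}
    (hK : ∀ᶠ τ in atImInfty, ‖g τ‖ ≤ Real.exp (K * τ.im)) (hne : ∃ τ, g τ ≠ 0) :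
    ∃ v : ℚ, IsOrderAtInfty g v := by
  have hh0 : (0 : ℝ) < h := by exact_mod_cast hh
  have hhC : (h : ℂ) ≠ 0 := by exact_mod_cast hh.ne'
  -- `M` bounds the order of the pole: multiplication by `q^{M/h}` makes the function bounded near
  -- `i∞`.
  obtain ⟨M, hM⟩ := exists_nat_ge (K * h / (2 * Real.pi))
  have hM : K ≤ 2 * Real.pi * (M / h : ℝ) := by
    rw [div_le_iff₀ (by positivity)] at hM
    rw [mul_div_assoc', le_div_iff₀ hh0]
    linarith
  -- The value `0` off the upper half plane is a filler that keeps `F` periodic on all of `ℂ`.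
  set F : ℂ → ℂ := fun z => if 0 < z.im then g (ofComplex z) * e ((M / h : ℝ) * z) else 0 with hF
  have hF1 : ∀ z : ℂ, 0 < z.im → F z = g (ofComplex z) * e ((M / h : ℝ) * z) := fun z hz =>
    if_pos hz
  have hFper : Function.Periodic F ((h : ℝ) : ℂ) := by
    intro z
    by_cases hz : 0 < z.im
    · have hz' : 0 < (z + ((h : ℝ) : ℂ)).im := by simpa using hz
      have h1 : ofComplex (z + ((h : ℝ) : ℂ)) = (h : ℝ) +ᵥ ofComplex z := by
        rw [ofComplex_apply_of_im_pos hz, ofComplex_apply_of_im_pos hz']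
        ext1
        simp [add_comm]
      have h2 : ((M / h : ℝ) : ℂ) * (z + ((h : ℝ) : ℂ)) = (M / h : ℝ) * z + ((M : ℤ) : ℂ) := by
        push_cast
        field_simp
      rw [hF1 _ hz, hF1 _ hz', h1, hper, h2, e_add, e_intCast, mul_one]
    · have hz' : ¬ 0 < (z + ((h : ℝ) : ℂ)).im := by simpa using hz
      simp only [hF]
      rw [if_neg hz, if_neg hz']
  have hFd : ∀ z : ℂ, 0 < z.im → DifferentiableAt ℂ F z := by
    intro z hz
    have he := differentiable_e
    have h1 : DifferentiableAt ℂ (fun z => g (ofComplex z) * e ((M / h : ℝ) * z)) z :=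
      (hol z hz).mul (by fun_prop)
    refine h1.congr_of_eventuallyEq ?_
    filter_upwards [(isOpen_lt continuous_const Complex.continuous_im).mem_nhds hz] with w hw
    exact hF1 w hw
  have hbd : (comap Complex.im atTop).BoundedAtFilter F := by
    obtain ⟨Y, hY⟩ := (atImInfty_mem _).1 hK
    refine Asymptotics.IsBigO.of_bound 1 ?_
    filter_upwards [preimage_mem_comap (Ioi_mem_atTop (max Y 0))] with z hz
    have hz : max Y 0 < z.im := hz
    have hz0 : 0 < z.im := (le_max_right _ _).trans_lt hz
    have h1 := hY (ofComplex z) (by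
      rw [ofComplex_apply_of_im_pos hz0]; exact ((le_max_left _ _).trans_lt hz).le)
    have h1 : ‖g (ofComplex z)‖ ≤ Real.exp (K * z.im) := by
      simpa [ofComplex_apply_of_im_pos hz0] using h1
    rw [hF1 z hz0, norm_mul, norm_e_real_mul]
    have h2 : Real.exp (K * z.im) * Real.exp (-(2 * Real.pi * (M / h : ℝ) * z.im)) ≤ 1 := by
      rw [← Real.exp_add, Real.exp_le_one_iff]
      linarith [mul_le_mul_of_nonneg_right hM hz0.le]
    calc _ ≤ Real.exp (K * z.im) * Real.exp (-(2 * Real.pi * (M / h : ℝ) * z.im)) := by gcongr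
      _ ≤ _ := by simpa using h2
  set Φ := Function.Periodic.cuspFunction h F with hΦ
  have hΦd : DifferentiableOn ℂ Φ (Metric.ball 0 1) := by
    intro q hq
    refine DifferentiableAt.differentiableWithinAt ?_
    by_cases hq0 : q = 0
    · rw [hq0]
      -- Boundedness near `i∞` makes the singularity at `q = 0` removable.
      refine Function.Periodic.differentiableAt_cuspFunction_zero hh0 hFper ?_ hbd
      filter_upwards [preimage_mem_comap (Ioi_mem_atTop 0)] with z hz
      exact hFd z hz
    · rw [← Function.Periodic.qParam_right_inv hh0.ne' hq0]
      refine Function.Periodic.differentiableAt_cuspFunction hh0.ne' hFper (hFd _ ?_)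
      rw [← Function.Periodic.norm_qParam_lt_iff hh0, Function.Periodic.qParam_right_inv hh0.ne' hq0]
      simpa using hq
  set b : ℕ → ℂ := fun m => (m.factorial : ℂ)⁻¹ * iteratedDeriv m Φ 0 with hb
  have hsum : ∀ τ : ℍ, HasSum (fun m : ℕ => b m * e ((m : ℂ) / h * τ)) (F τ) := by
    intro τ
    have h1 : Function.Periodic.qParam h τ ∈ Metric.ball (0 : ℂ) 1 := by
      simpa using Function.Periodic.norm_qParam_lt_one hh0 τ.im_pos
    have h2 := Complex.hasSum_taylorSeries_on_ball hΦd h1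
    rw [hΦ, Function.Periodic.eq_cuspFunction hh0.ne' hFper] at h2
    refine h2.congr_fun fun m => ?_
    have h3 : (Function.Periodic.qParam h τ - 0) ^ m = e ((m : ℂ) / h * τ) := by
      have h4 : Function.Periodic.qParam h τ = e (τ / h) := by
        rw [Function.Periodic.qParam, e]
        congr 1
        push_cast
        ring
      rw [sub_zero, h4, e_pow]
      congr 1
      ring
    rw [h3]
    simp only [hb, smul_eq_mul]
    ring
  set ι : ℕ → ℤ := fun m => (m : ℤ) - M with hι
  have hinj : Function.Injective ι := fun m k hmk => by
    simp only [hι] at hmk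
    omega
  set a : ℤ → ℂ := fun n => if -(M : ℤ) ≤ n then b (n + M).toNat else 0 with ha
  have hal : ∀ m : ℕ, a (ι m) = b m := fun m => by
    simp [ha, hι]
  have hexp : ∀ τ : ℍ, HasSum (fun n : ℤ => a n * e ((n : ℂ) / (h : ℂ) * (τ : ℂ))) (g τ) := by
    intro τ
    have hgτ : F τ * e (-((M / h : ℝ) * τ)) = g τ := by
      rw [hF1 _ τ.im_pos, ofComplex_apply, mul_assoc, ← e_add, add_neg_cancel]
      simpa using congrArg (g τ * ·) (e_intCast 0)
    rw [← hgτ, ← hinj.hasSum_iff]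
    · refine ((hsum τ).mul_right (e (-((M / h : ℝ) * τ)))).congr_fun fun m => ?_
      rw [Function.comp_apply, hal, mul_assoc (b m), ← e_add]
      congr 2
      simp only [hι]
      push_cast
      ring
    · intro n hn
      have : ¬ -(M : ℤ) ≤ n := fun h => hn ⟨(n + M).toNat, by simp only [hι]; omega⟩
      simp [ha, this]
  obtain ⟨n₀, hn₀, hmin⟩ := Int.exists_least_of_bdd (P := fun n => a n ≠ 0)
    ⟨-(M : ℤ), fun n hn => by
      by_contra hlt
      exact hn (if_neg hlt)⟩
    (by
      by_contra hall
      push Not at hall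
      obtain ⟨τ, hτ⟩ := hne
      have := hexp τ
      simp only [hall, zero_mul] at this
      exact hτ (this.unique hasSum_zero))
  exact ⟨_, h, a, n₀, hh, hexp, ⟨hn₀, fun n hn => hmin n hn⟩, rfl⟩

/-- The leading term of a Fourier expansion governs the growth at infinity. -/
lemma IsOrderAtInfty.tendsto_norm {g : ℍ → ℂ} {v : ℚ} (hg : IsOrderAtInfty g v) :
    ∃ l : ℝ, 0 < l ∧ Tendsto (fun τ : ℍ => ‖g τ‖ * Real.exp (2 * Real.pi * v * τ.im)) atImInfty
      (𝓝 l) := by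
  obtain ⟨h, a, n₀, hh, hsum, ⟨hn₀, hmin⟩, hv⟩ := hg
  have hh0 : (0 : ℝ) < h := by exact_mod_cast hh
  refine ⟨‖a n₀‖, norm_pos_iff.2 hn₀, ?_⟩
  set f : ℍ → ℤ → ℂ := fun τ n => a n * e (((n - n₀ : ℝ) / h : ℝ) * (τ : ℂ)) with hf
  have hnf : ∀ τ n, ‖f τ n‖ = ‖a n‖ * Real.exp (-(2 * Real.pi * ((n - n₀ : ℝ) / h) * τ.im)) :=
    fun τ n => by
      simp only [hf]
      rw [norm_mul, norm_e_real_mul]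
      rfl
  have hfs : ∀ τ, HasSum (f τ) (g τ * e (-((n₀ / h : ℝ)) * (τ : ℂ))) := by
    intro τ
    refine ((hsum τ).mul_right _).congr_fun fun n => ?_
    simp only [hf]
    rw [mul_assoc, ← e_add]
    congr 2
    push_cast
    ring
  have him : Tendsto (fun τ : ℍ => τ.im) atImInfty atTop := tendsto_comap
  have hlim : Tendsto (fun τ => ∑' n, f τ n) atImInfty (𝓝 (∑' n, if n = n₀ then a n₀ else 0)) := by
    -- Once the leading exponent is divided out, all exponents that occur are nonnegative, so for
    -- `Im τ ≥ 1` each term is dominated by its value at `i`.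
    refine tendsto_tsum_of_dominated_convergence (bound := fun n => ‖f I n‖)
      (hfs I).summable.norm ?_ ?_
    · intro n
      by_cases hn : n = n₀
      · subst hn
        have : ∀ τ, f τ n = a n := fun τ => by
          simp only [hf, sub_self, zero_div, Complex.ofReal_zero, zero_mul]
          simpa using congrArg (a n * ·) (e_intCast 0)
        simp only [this, if_true]
        exact tendsto_const_nhds
      · rw [if_neg hn]
        by_cases han : a n = 0
        · simp only [hf, han, zero_mul]
          exact tendsto_const_nhds
        · have hlt : n₀ < n := lt_of_le_of_ne (hmin han) (Ne.symm hn)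
          have hlt : (n₀ : ℝ) < n := by exact_mod_cast hlt
          rw [tendsto_zero_iff_norm_tendsto_zero]
          simp only [hnf]
          have hpos : 0 < 2 * Real.pi * ((n - n₀ : ℝ) / h) := by
            have : (0 : ℝ) < n - n₀ := by linarith
            positivity
          have := (Real.tendsto_exp_neg_atTop_nhds_zero.comp
            (him.const_mul_atTop hpos)).const_mul ‖a n‖
          simpa using this
    · filter_upwards [him.eventually_ge_atTop 1] with τ hτ n
      rw [hnf, hnf]
      by_cases han : a n = 0
      · simp [han]
      · have hle : (n₀ : ℝ) ≤ n := by exact_mod_cast hmin han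
        have : 0 ≤ 2 * Real.pi * ((n - n₀ : ℝ) / h) := by
          have : (0 : ℝ) ≤ n - n₀ := by linarith
          positivity
        have h1 := mul_le_mul_of_nonneg_left hτ this
        rw [I_im]
        gcongr
  rw [tsum_ite_eq] at hlim
  refine hlim.norm.congr fun τ => ?_
  rw [(hfs τ).tsum_eq, norm_mul, ← Complex.ofReal_neg, norm_e_real_mul, hv]
  congr 2
  push_cast
  rw [coe_im]
  ring

/-- Translation multiplies each coefficient by a nonzero number, so the same exponents occur. -/
lemma IsOrderAtInfty.translate {g : ℍ → ℂ} {v : ℚ} (hg : IsOrderAtInfty g v) (k : ℤ) :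
    IsOrderAtInfty (fun τ => g ((k : ℝ) +ᵥ τ)) v := by
  obtain ⟨h, a, n₀, hh, hsum, ⟨hn₀, hmin⟩, hv⟩ := hg
  refine ⟨h, fun n => a n * e ((n : ℂ) / h * k), n₀, hh, fun τ => ?_,
    ⟨mul_ne_zero hn₀ (e_ne_zero _), fun n hn => hmin (left_ne_zero_of_mul hn)⟩, hv⟩
  refine (hsum _).congr_fun fun n => ?_
  rw [mul_assoc, ← e_add]
  congr 2
  simp
  ring

/-- The point `x + iy` for `y > 0`, and `x + i` otherwise. -/
noncomputable def vertical (x y : ℝ) : ℍ :=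
  if hy : 0 < y then ⟨x + y * Complex.I, by simpa using hy⟩ else ⟨x + Complex.I, by simp⟩

lemma coe_vertical (x : ℝ) {y : ℝ} (hy : 0 < y) : (vertical x y : ℂ) = x + y * Complex.I := by
  rw [vertical, dif_pos hy]

lemma vertical_im (x : ℝ) {y : ℝ} (hy : 0 < y) : (vertical x y).im = y := by
  rw [← coe_im, coe_vertical x hy]
  simp

lemma IsOrderAtInfty.tendsto_norm_vertical {g : ℍ → ℂ} {v : ℚ} (hg : IsOrderAtInfty g v) (x : ℝ) :
    ∃ l : ℝ, 0 < l ∧ Tendsto (fun y : ℝ => ‖g (vertical x y)‖ * Real.exp (2 * Real.pi * v * y)) atTop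
      (𝓝 l) := by
  obtain ⟨l, hl, h⟩ := hg.tendsto_norm
  refine ⟨l, hl, ?_⟩
  have h1 : Tendsto (vertical x) atTop atImInfty := by
    refine tendsto_comap_iff.2 (tendsto_id.congr' ?_)
    filter_upwards [Ioi_mem_atTop 0] with y hy
    exact (vertical_im x hy).symm
  refine (h.comp h1).congr' ?_
  filter_upwards [Ioi_mem_atTop 0] with y hy
  rw [Function.comp_apply, vertical_im x hy]

/-- The leading term dominates uniformly in the real part, so a bound on a single vertical line is
enough. -/
lemma IsOrderAtInfty.le_of_norm_le {g : ℍ → ℂ} {v : ℚ} (hg : IsOrderAtInfty g v) {x β : ℝ}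
    (h : ∀ᶠ y in atTop, ‖g (vertical x y)‖ ≤ Real.exp (β * y)) : -(2 * Real.pi * v) ≤ β := by
  obtain ⟨l, hl, hlim⟩ := hg.tendsto_norm_vertical x
  by_contra! hlt
  have h0 : Tendsto (fun y : ℝ => Real.exp (-(-(β + 2 * Real.pi * v) * y))) atTop (𝓝 0) :=
    Real.tendsto_exp_neg_atTop_nhds_zero.comp (tendsto_id.const_mul_atTop (by linarith))
  refine hl.not_ge (le_of_tendsto_of_tendsto hlim h0 ?_)
  filter_upwards [h] with y hy
  calc _ ≤ Real.exp (β * y) * Real.exp (2 * Real.pi * v * y) := by gcongr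
    _ = _ := by
      rw [← Real.exp_add]
      ring_nf

lemma IsOrderAtInfty.le_of_le_norm {g : ℍ → ℂ} {v : ℚ} (hg : IsOrderAtInfty g v) {x β : ℝ}
    (h : ∀ᶠ y in atTop, Real.exp (β * y) ≤ ‖g (vertical x y)‖) : β ≤ -(2 * Real.pi * v) := by
  obtain ⟨l, hl, hlim⟩ := hg.tendsto_norm_vertical x
  by_contra! hlt
  have h0 : Tendsto (fun y : ℝ => Real.exp ((β + 2 * Real.pi * v) * y)) atTop atTop :=
    Real.tendsto_exp_atTop.comp (tendsto_id.const_mul_atTop (by linarith))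
  refine not_tendsto_nhds_of_tendsto_atTop (tendsto_atTop_mono' _ ?_ h0) l hlim
  filter_upwards [h] with y hy
  calc _ = Real.exp (β * y) * Real.exp (2 * Real.pi * v * y) := by
        rw [← Real.exp_add]
        ring_nf
    _ ≤ _ := by gcongr

/-! ### Modular Nahm sums -/

lemma coe_SL2_smul (γ : SL(2, ℤ)) (τ : ℍ) :
    ((γ • τ : ℍ) : ℂ) = ((γ 0 0 : ℤ) * (τ : ℂ) + (γ 0 1 : ℤ)) / ((γ 1 0 : ℤ) * (τ : ℂ) + (γ 1 1 : ℤ)) := by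
  rw [coe_specialLinearGroup_apply]
  simp

lemma SL2_det (γ : SL(2, ℤ)) : γ 0 0 * γ 1 1 - γ 0 1 * γ 1 0 = 1 := by
  have := γ.det_coe
  rwa [Matrix.det_fin_two] at this

lemma SL2_denom_ne_zero (γ : SL(2, ℤ)) {z : ℂ} (hz : 0 < z.im) :
    ((γ 1 0 : ℤ) : ℂ) * z + (γ 1 1 : ℤ) ≠ 0 := by
  intro h
  have h1 := congrArg Complex.im h
  have h2 := congrArg Complex.re h
  simp only [Complex.add_im, Complex.mul_im, Complex.intCast_re, Complex.intCast_im, zero_mul,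
    add_zero, Complex.zero_im, mul_eq_zero, hz.ne', or_false, Complex.add_re, Complex.mul_re,
    sub_zero, Complex.zero_re] at h1 h2
  rw [h1, zero_mul, zero_add] at h2
  have h3 : γ 1 0 = 0 := by exact_mod_cast h1
  have h4 : γ 1 1 = 0 := by exact_mod_cast h2
  have := SL2_det γ
  rw [h3, h4] at this
  simp at this

lemma SL2_smul_im (γ : SL(2, ℤ)) (τ : ℍ) :
    (γ • τ).im = τ.im / (((γ 1 0 : ℤ) * τ.re + (γ 1 1 : ℤ)) ^ 2 + ((γ 1 0 : ℤ) * τ.im) ^ 2) := by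
  rw [ModularGroup.im_smul_eq_div_normSq, ModularGroup.denom_apply, Complex.normSq_apply]
  simp
  ring_nf

lemma differentiableAt_nahmSum_smul (hA : IsPosDef A) (B : Fin N → ℚ) (C : ℚ) (γ : SL(2, ℤ)) {z : ℂ}
    (hz : 0 < z.im) : DifferentiableAt ℂ (fun w => nahmSum A B C (γ • ofComplex w)) z := by
  set m : ℂ → ℂ := fun w => ((γ 0 0 : ℤ) * w + (γ 0 1 : ℤ)) / ((γ 1 0 : ℤ) * w + (γ 1 1 : ℤ)) with hm
  have hcoe : ∀ w : ℂ, 0 < w.im → ((γ • ofComplex w : ℍ) : ℂ) = m w := fun w hw => by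
    rw [coe_SL2_smul, ofComplex_apply_of_im_pos hw]
  have h1 : DifferentiableAt ℂ m z :=
    DifferentiableAt.div (by fun_prop) (by fun_prop) (SL2_denom_ne_zero γ hz)
  have h2 : 0 < (m z).im := by
    rw [← hcoe z hz]
    exact (γ • ofComplex z).im_pos
  refine ((differentiableAt_nahmFun hA B C h2).comp z h1).congr_of_eventuallyEq ?_
  filter_upwards [(isOpen_lt continuous_const Complex.continuous_im).mem_nhds hz] with w hw
  rw [Function.comp_apply, ← hcoe w hw]
  rfl

lemma tendsto_const_div_nhdsGT {κ : ℝ} (hκ : 0 < κ) : Tendsto (fun y : ℝ => κ / y) atTop (𝓝[>] 0) := by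
  refine tendsto_nhdsWithin_iff.2 ⟨tendsto_const_nhds.div_atTop tendsto_id, ?_⟩
  filter_upwards [Ioi_mem_atTop 0] with y hy
  exact div_pos hκ hy

/-- A modular Nahm sum has an order at every cusp other than `∞`. -/
lemma exists_isOrderAtInfty_smul (hA : IsPosDef A) (B : Fin N → ℚ) (C : ℚ)
    (hmod : IsModular (nahmSum A B C)) {γ : SL(2, ℤ)} (hγ : γ 1 0 ≠ 0) :
    ∃ v : ℚ, IsOrderAtInfty (fun τ => nahmSum A B C (γ • τ)) v := by
  obtain ⟨Γ, hΓ, hinv⟩ := hmod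
  -- Finite index puts a power of the conjugated translation into `Γ`; this `h` is a period of `f ∘
  -- γ`.
  obtain ⟨h, hh, -, hmem⟩ := Subgroup.exists_pow_mem_of_index_ne_zero hΓ.index_ne_zero
    (γ * ModularGroup.T * γ⁻¹)
  have hh0 : (0 : ℝ) < h := by exact_mod_cast hh
  have hper : ∀ (k : ℤ) (τ : ℍ), nahmSum A B C (γ • (((h * k : ℤ) : ℝ) +ᵥ τ)) =
      nahmSum A B C (γ • τ) := by
    intro k τ
    have h1 := hinv _ (Γ.zpow_mem hmem k) (γ • τ)
    rw [← zpow_natCast, ← zpow_mul, conj_zpow, smul_smul, inv_mul_cancel_right, mul_smul,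
      modular_T_zpow_smul] at h1
    exact h1
  obtain ⟨G, hG0, hG⟩ := exists_eventually_norm_nahmFun_le hA B C
  set c : ℝ := ((γ 1 0 : ℤ) : ℝ) with hc
  set d : ℝ := ((γ 1 1 : ℤ) : ℝ) with hd
  have hc1 : 1 ≤ c ^ 2 := by
    have : (1 : ℤ) ≤ (γ 1 0) ^ 2 := by
      have := sq_pos_of_ne_zero hγ
      omega
    rw [hc]
    exact_mod_cast this
  -- Bounds `|cσ + d|²/(Im σ)²` when `0 ≤ Re σ ≤ h` and `Im σ ≥ 1`, so that `Im γσ` is at least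
  -- `1/(L·Im σ)`.
  set L : ℝ := (|c| * h + |d|) ^ 2 + c ^ 2 with hL
  have hL0 : 0 < L := by positivity
  refine exists_isOrderAtInfty hh (fun τ => ?_)
    (fun z hz => differentiableAt_nahmSum_smul hA B C γ hz) (K := G * L / (2 * Real.pi)) ?_ ?_
  · simpa using hper 1 τ
  · obtain ⟨ε₀, hε₀, hε⟩ := mem_nhdsGT_iff_exists_Ioo_subset.1 hG
    have hε₀ : 0 < ε₀ := hε₀
    refine (atImInfty_mem _).2 ⟨max 1 (2 * Real.pi / ε₀ + 1), fun τ hτ => ?_⟩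
    have hτ1 : 1 ≤ τ.im := (le_max_left _ _).trans hτ
    have hτ2 : 2 * Real.pi / ε₀ < τ.im := by linarith [(le_max_right _ _).trans hτ]
    -- Periodicity moves the real part into `[0, h]`, without which `Im γτ` has no lower bound in
    -- terms of `Im τ` alone.
    set k : ℤ := -⌊τ.re / h⌋ with hk
    set σ : ℍ := ((h * k : ℤ) : ℝ) +ᵥ τ with hσ
    have hσim : σ.im = τ.im := by simp [hσ]
    have hσre : σ.re = h * Int.fract (τ.re / h) := by
      have : τ.re = h * (τ.re / h) := by field_simp
      simp only [hσ, vadd_re, Int.fract, hk]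
      push_cast
      linear_combination this
    have hre0 : 0 ≤ σ.re := by rw [hσre]; exact mul_nonneg hh0.le (Int.fract_nonneg _)
    have hre1 : σ.re ≤ h := by
      rw [hσre]; exact mul_le_of_le_one_right hh0.le (Int.fract_lt_one _).le
    have him := SL2_smul_im γ σ
    rw [hσim, ← hc, ← hd] at him
    set P : ℝ := (c * σ.re + d) ^ 2 + (c * τ.im) ^ 2 with hP
    have hP1 : τ.im ^ 2 ≤ P := by
      rw [hP, mul_pow]
      nlinarith [sq_nonneg (c * σ.re + d), sq_nonneg τ.im]
    have hP2 : P ≤ L * τ.im ^ 2 := by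
      have h1 : |c * σ.re + d| ≤ |c| * h + |d| := by
        refine (abs_add_le _ _).trans ?_
        rw [abs_mul, abs_of_nonneg hre0]
        gcongr
      have h2 : (c * σ.re + d) ^ 2 ≤ (|c| * h + |d|) ^ 2 := by
        rw [← sq_abs (c * σ.re + d)]
        gcongr
      have h3 : (|c| * h + |d|) ^ 2 ≤ (|c| * h + |d|) ^ 2 * τ.im ^ 2 :=
        le_mul_of_one_le_right (by positivity) (one_le_pow₀ hτ1)
      rw [hP, hL, add_mul, mul_pow]
      linarith
    have hy0 : 0 < τ.im := τ.im_pos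
    have hP0 : 0 < P := lt_of_lt_of_le (by positivity) hP1
    have hmem : 2 * Real.pi * (γ • σ).im ∈ Set.Ioo 0 ε₀ := by
      refine ⟨by have := (γ • σ).im_pos; positivity, ?_⟩
      rw [him]
      rw [div_lt_iff₀ hε₀] at hτ2
      rw [mul_div_assoc', div_lt_iff₀ hP0]
      nlinarith [mul_lt_mul_of_pos_right hτ2 hy0, mul_le_mul_of_nonneg_left hP1 hε₀.le]
    have h1 := hε hmem (γ • σ : ℍ) rfl
    have h2 : nahmSum A B C (γ • τ) = nahmFun A B C (γ • σ : ℍ) := (hper k τ).symm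
    change ‖nahmSum A B C (γ • τ)‖ ≤ _
    rw [h2]
    refine h1.trans (Real.exp_le_exp.2 ?_)
    rw [him, div_le_iff₀ (by positivity)]
    have h3 : G * L / (2 * Real.pi) * τ.im * (2 * Real.pi * (τ.im / P)) = G * (L * τ.im ^ 2 / P) := by
      field_simp
    rw [h3]
    exact le_mul_of_one_le_right hG0 ((one_le_div hP0).2 hP2)
  · refine ⟨γ⁻¹ • I, ?_⟩
    rw [smul_inv_smul]
    have := nahmFun_mul_I_ne_zero hA B C one_pos
    rw [Complex.ofReal_one, one_mul] at this
    exact this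

/-- Above the pole `-d/c` the denominator is purely imaginary, so the vertical line goes to the
vertical ray above `a/c`, where the growth estimates apply. -/
lemma SL2_smul_vertical {γ : SL(2, ℤ)} (hγ : γ 1 0 ≠ 0) {y : ℝ} (hy : 0 < y) :
    ((γ • vertical (-(γ 1 1 : ℤ) / (γ 1 0 : ℤ)) y : ℍ) : ℂ) =
      (((γ 0 0 : ℤ) / (γ 1 0 : ℤ) : ℝ) : ℂ) + ((1 / ((γ 1 0 : ℤ) ^ 2 * y) : ℝ) : ℂ) * Complex.I := by
  have hc : ((γ 1 0 : ℤ) : ℂ) ≠ 0 := by exact_mod_cast hγ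
  have hyC : (y : ℂ) ≠ 0 := by exact_mod_cast hy.ne'
  have hdet : ((γ 0 0 : ℤ) : ℂ) * (γ 1 1 : ℤ) - (γ 0 1 : ℤ) * (γ 1 0 : ℤ) = 1 := by
    exact_mod_cast SL2_det γ
  rw [coe_SL2_smul, coe_vertical _ hy]
  push_cast
  have h1 : ((γ 1 0 : ℤ) : ℂ) * (-((γ 1 1 : ℤ) : ℂ) / (γ 1 0 : ℤ) + y * Complex.I) + (γ 1 1 : ℤ) =
      (γ 1 0 : ℤ) * y * Complex.I := by
    field_simp
    ring
  rw [h1, div_eq_iff (by simp [hc, hyC])]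
  field_simp
  linear_combination (-1 : ℂ) * hdet - Complex.I_mul_I

lemma isPrimitiveRoot_e_div {a c : ℤ} (hc : c ≠ 0) (hac : IsCoprime a c) :
    IsPrimitiveRoot (e ((a / c : ℝ) : ℝ)) c.natAbs := by
  have hcC : (c : ℂ) ≠ 0 := by exact_mod_cast hc
  have key : ∀ k : ℕ, e ((a / c : ℝ) : ℝ) ^ k = 1 ↔ c ∣ k := by
    intro k
    rw [e_pow, e, Complex.exp_eq_one_iff]
    constructor
    · rintro ⟨m, hm⟩
      have h1 : (k : ℂ) * ((a / c : ℝ) : ℝ) = m := by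
        have h2 : (2 * (Real.pi : ℂ) * Complex.I) ≠ 0 := Complex.two_pi_I_ne_zero
        refine mul_left_cancel₀ h2 ?_
        linear_combination hm
      push_cast at h1
      field_simp at h1
      have h3 : (k : ℤ) * a = c * m := by exact_mod_cast h1
      exact hac.symm.dvd_of_dvd_mul_right (Dvd.intro m h3.symm)
    · rintro ⟨m, hm⟩
      refine ⟨a * m, ?_⟩
      have h1 : (k : ℂ) = c * m := by exact_mod_cast hm
      rw [h1]
      push_cast
      field_simp
  refine ⟨?_, fun k hk => ?_⟩
  · rw [key]
    exact Int.dvd_natAbs_self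
  · exact Int.natAbs_dvd_natAbs.2 ((key k).1 hk)

/-- On the ray above `a/c` one has `1/ε = c²y/(2π)`, which cancels the `c²` in `growth A / c²`; the
resulting bound does not depend on the cusp. -/
lemma C0_le_of_isOrderAtInfty (hA : IsPosDef A) (B : Fin N → ℚ) (C : ℚ) {γ : SL(2, ℤ)}
    (hγ : γ 1 0 ≠ 0) {v : ℚ} (hv : IsOrderAtInfty (fun τ => nahmSum A B C (γ • τ)) v) :
    C0 A ≤ v := by
  set a : ℤ := γ 0 0 with ha
  set c : ℤ := γ 1 0 with hc
  have hc0 : 0 < c.natAbs := Int.natAbs_pos.2 hγ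
  have hcs : ((c.natAbs : ℕ) : ℝ) ^ 2 = (c : ℝ) ^ 2 := by
    rw [Nat.cast_natAbs, Int.cast_abs, sq_abs]
  have hcR : (c : ℝ) ≠ 0 := by exact_mod_cast hγ
  have hac : IsCoprime a c := ⟨γ 1 1, -γ 0 1, by linear_combination SL2_det γ⟩
  have key : ∀ η : ℝ, 0 < η →
      -(2 * Real.pi * v) ≤ (growth A + η * c ^ 2) / (2 * Real.pi) := by
    intro η hη
    refine hv.le_of_norm_le (x := -(γ 1 1 : ℤ) / (γ 1 0 : ℤ)) ?_
    have h1 := (tendsto_const_div_nhdsGT (by positivity : 0 < 2 * Real.pi / (c : ℝ) ^ 2)).eventually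
      (eventually_norm_nahmFun_le_of_isPrimitiveRoot hA B C hc0 (isPrimitiveRoot_e_div hγ hac) hη)
    filter_upwards [h1, Ioi_mem_atTop 0] with y hy hy0
    have hy0 : 0 < y := hy0
    have h2 := SL2_smul_vertical hγ hy0
    have h3 := hy (γ • vertical (-(γ 1 1 : ℤ) / (γ 1 0 : ℤ)) y : ℍ)
      (by
        rw [h2, Complex.add_im, Complex.ofReal_im, zero_add, Complex.im_ofReal_mul, Complex.I_im,
          ← hc]
        field_simp)
      (by
        rw [h2, Complex.add_re, Complex.ofReal_re, Complex.re_ofReal_mul, Complex.I_re, mul_zero,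
          add_zero])
    refine le_trans h3 (Real.exp_le_exp.2 (le_of_eq ?_))
    rw [hcs]
    field_simp
  have h1 : -(2 * Real.pi * v) ≤ growth A / (2 * Real.pi) := by
    refine le_of_forall_pos_le_add fun δ hδ => ?_
    refine (key (δ * (2 * Real.pi) / c ^ 2) (by positivity)).trans (le_of_eq ?_)
    field_simp
  rw [le_div_iff₀ (by positivity), growth] at h1
  have h2 : (2 * Real.pi) ^ 2 * C0 A ≤ (2 * Real.pi) ^ 2 * v := by linarith
  exact le_of_mul_le_mul_left h2 (by positivity)

/-- The inversion sends `iy` to `i/y`, so the lower bound on the imaginary axis applies with `ε =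
2π/y`. -/
lemma le_C0_of_isOrderAtInfty (hA : IsPosDef A) (B : Fin N → ℚ) (C : ℚ) {v : ℚ}
    (hv : IsOrderAtInfty (fun τ => nahmSum A B C (ModularGroup.S • τ)) v) :
    (v : ℝ) ≤ C0 A := by
  have key : ∀ η : ℝ, 0 < η → (growth A - η) / (2 * Real.pi) ≤ -(2 * Real.pi * v) := by
    intro η hη
    refine hv.le_of_le_norm (x := 0) ?_
    have h1 := (tendsto_const_div_nhdsGT (by positivity : 0 < 2 * Real.pi)).eventually
      (eventually_le_norm_nahmFun hA B C hη)
    filter_upwards [h1, Ioi_mem_atTop 0] with y hy hy0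
    have hy0 : 0 < y := hy0
    have hS : ModularGroup.S 1 0 ≠ 0 := by simp [ModularGroup.S]
    have h2 := SL2_smul_vertical hS hy0
    have h3 : ((2 * Real.pi / y / (2 * Real.pi) : ℝ) : ℂ) * Complex.I =
        (ModularGroup.S • vertical 0 y : ℍ) := by
      have h4 : 2 * Real.pi / y / (2 * Real.pi) = 1 / y := by field_simp
      simp only [ModularGroup.S] at h2 ⊢
      simp at h2
      rw [h2, h4]
      simp
    rw [h3] at hy
    refine le_trans (Real.exp_le_exp.2 (le_of_eq ?_)) hy
    field_simp
  have h1 : growth A / (2 * Real.pi) ≤ -(2 * Real.pi * v) := by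
    refine le_of_forall_pos_le_add fun δ hδ => ?_
    have := key (δ * (2 * Real.pi)) (by positivity)
    rw [sub_div, mul_div_cancel_right₀ _ (by positivity)] at this
    linarith
  rw [div_le_iff₀ (by positivity), growth] at h1
  have h2 : (2 * Real.pi) ^ 2 * v ≤ (2 * Real.pi) ^ 2 * C0 A := by linarith
  exact le_of_mul_le_mul_left h2 (by positivity)

/-- Up to an element of `Γ`, every element of `SL(2,ℤ)` has nonzero lower left entry. -/
lemma exists_mul_lower_left_ne_zero (Γ : Subgroup SL(2, ℤ)) [hΓ : Γ.FiniteIndex] (γ : SL(2, ℤ)) :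
    ∃ δ ∈ Γ, (δ * γ) 1 0 ≠ 0 := by
  by_cases hγ : γ 1 0 = 0
  · set U : SL(2, ℤ) := ⟨!![1, 0; 1, 1], by simp⟩ with hU
    have hpow : ∀ m : ℕ, (U ^ m) 1 0 = m ∧ (U ^ m) 1 1 = 1 := by
      intro m
      induction m with
      | zero => simp
      | succ m ih =>
        have h10 : U 1 0 = 1 := rfl
        have h11 : U 1 1 = 1 := rfl
        have h00 : U 0 0 = 1 := rfl
        have h01 : U 0 1 = 0 := rfl
        rw [pow_succ, Matrix.SpecialLinearGroup.coe_mul, Matrix.mul_apply, Matrix.mul_apply,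
          Fin.sum_univ_two, Fin.sum_univ_two, ih.1, ih.2, h00, h01, h10, h11]
        simp
    obtain ⟨m, hm, -, hmem⟩ := Subgroup.exists_pow_mem_of_index_ne_zero hΓ.index_ne_zero U
    refine ⟨_, hmem, ?_⟩
    -- The bottom row of `U^m` is `(m, 1)`; when `γ 1 0 = 0` the determinant forces `γ 0 0 ≠ 0`.
    have h1 : (U ^ m * γ) 1 0 = m * γ 0 0 := by
      rw [Matrix.SpecialLinearGroup.coe_mul, Matrix.mul_apply, Fin.sum_univ_two, (hpow m).1,
        (hpow m).2, hγ]
      ring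
    rw [h1]
    refine mul_ne_zero (by exact_mod_cast hm.ne') fun h => ?_
    have := SL2_det γ
    rw [h, hγ] at this
    simp at this
  · exact ⟨1, Γ.one_mem, by rwa [one_mul]⟩

lemma exists_smul_eq_vadd {γ : SL(2, ℤ)} (hγ : γ 1 0 = 0) :
    ∃ k : ℤ, ∀ τ : ℍ, γ • τ = (k : ℝ) +ᵥ τ := by
  have hdet := SL2_det γ
  rw [hγ, mul_zero, sub_zero] at hdet
  -- Here `u = ±1` is the common diagonal entry; both signs act as translations.
  have h : ∀ u : ℤ, γ 0 0 = u → γ 1 1 = u → u * u = 1 → ∀ τ : ℍ,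
      γ • τ = ((u * γ 0 1 : ℤ) : ℝ) +ᵥ τ := by
    intro u h0 h1 hu τ
    have huC : (u : ℂ) * u = 1 := by exact_mod_cast hu
    have hu0 : (u : ℂ) ≠ 0 := left_ne_zero_of_mul_eq_one huC
    ext1
    rw [coe_SL2_smul, h0, h1, hγ, coe_vadd]
    push_cast
    rw [zero_mul, zero_add, div_eq_iff hu0]
    linear_combination (-((γ 0 1 : ℤ) : ℂ)) * huC
  rcases Int.eq_one_or_neg_one_of_mul_eq_one' hdet with ⟨h0, h1⟩ | ⟨h0, h1⟩
  · exact ⟨_, h 1 h0 h1 rfl⟩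
  · exact ⟨_, h (-1) h0 h1 rfl⟩

lemma lower_left_eq_zero_of_smul_infty {γ : SL(2, ℤ)}
    (h : Matrix.SpecialLinearGroup.mapGL ℚ γ • (OnePoint.infty : OnePoint ℚ) = OnePoint.infty) :
    γ 1 0 = 0 := by
  rw [OnePoint.smul_infty_eq_self_iff] at h
  simpa using h

lemma S_smul_infty : Matrix.SpecialLinearGroup.mapGL ℚ ModularGroup.S •
    (OnePoint.infty : OnePoint ℚ) = ((0 : ℚ) : OnePoint ℚ) := by
  rw [OnePoint.smul_infty_eq_ite]
  simp

lemma IsModular.exists_isOrderAtInfty_smul (hA : IsPosDef A) (B : Fin N → ℚ) (C : ℚ)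
    (hmod : IsModular (nahmSum A B C)) (γ : SL(2, ℤ)) :
    ∃ v : ℚ, IsOrderAtInfty (fun τ => nahmSum A B C (γ • τ)) v := by
  obtain ⟨Γ, hΓ, hinv⟩ := id hmod
  obtain ⟨δ, hδ, hne⟩ := exists_mul_lower_left_ne_zero Γ γ
  obtain ⟨v, hv⟩ := Nahm.exists_isOrderAtInfty_smul hA B C hmod hne
  exact ⟨v, by simpa only [mul_smul, hinv δ hδ] using hv⟩

/-- Two matrices sending `∞` to `P` differ on the right by a stabilizer of `∞`, which acts as an
integral translation; hence the order found for one serves for all. -/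
lemma IsModular.exists_isValuationAt (hA : IsPosDef A) (B : Fin N → ℚ) (C : ℚ)
    (hmod : IsModular (nahmSum A B C)) (P : OnePoint ℚ) :
    ∃ v : ℚ, IsValuationAt (nahmSum A B C) P v := by
  obtain ⟨γ₀, hγ₀⟩ := P.exists_mem_SL2 ℤ
  obtain ⟨v, hv⟩ := hmod.exists_isOrderAtInfty_smul hA B C γ₀
  refine ⟨v, fun γ hγ => ?_⟩
  have h1 : (γ₀⁻¹ * γ) 1 0 = 0 := lower_left_eq_zero_of_smul_infty (by
    rw [map_mul, mul_smul, hγ, ← hγ₀, map_inv, inv_smul_smul])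
  obtain ⟨k, hk⟩ := exists_smul_eq_vadd h1
  have h2 : ∀ τ : ℍ, γ • τ = γ₀ • ((k : ℝ) +ᵥ τ) := fun τ => by
    rw [← hk, smul_smul, mul_inv_cancel_left]
  simpa only [h2] using hv.translate k

lemma IsModular.C0_le_of_isValuationAt (hA : IsPosDef A) (B : Fin N → ℚ) (C : ℚ)
    (hmod : IsModular (nahmSum A B C)) {P : OnePoint ℚ} {v : ℚ}
    (hv : IsValuationAt (nahmSum A B C) P v) : C0 A ≤ v := by
  obtain ⟨γ, hγ⟩ := P.exists_mem_SL2 ℤ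
  obtain ⟨Γ, hΓ, hinv⟩ := hmod
  obtain ⟨δ, hδ, hne⟩ := exists_mul_lower_left_ne_zero Γ γ
  exact C0_le_of_isOrderAtInfty hA B C hne (by simpa only [mul_smul, hinv δ hδ] using hv γ hγ)

end Nahm

theorem mainTheorem5 {N : ℕ} (A : Matrix (Fin N) (Fin N) ℚ) (hA : Nahm.IsPosDef A)
    (B : Fin N → ℚ) (C : ℚ) (hmod : Nahm.IsModular (Nahm.nahmSum A B C)) :
    (∀ P : OnePoint ℚ, ∃ v : ℚ, Nahm.IsValuationAt (Nahm.nahmSum A B C) P v) ∧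
    (∀ (P : OnePoint ℚ) (v : ℚ), Nahm.IsValuationAt (Nahm.nahmSum A B C) P v →
      Nahm.C0 A ≤ (v : ℝ)) ∧
    (∀ v : ℚ, Nahm.IsValuationAt (Nahm.nahmSum A B C) ((0 : ℚ) : OnePoint ℚ) v →
      (v : ℝ) = Nahm.C0 A) := by
  exact ⟨hmod.exists_isValuationAt hA B C,
    fun _ _ hv => hmod.C0_le_of_isValuationAt hA B C hv,
    fun _ hv => le_antisymm (Nahm.le_C0_of_isOrderAtInfty hA B C (hv _ Nahm.S_smul_infty))
      (hmod.C0_le_of_isValuationAt hA B C hv)⟩
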